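/- Let $n \ge 2$, let $t_0 < t_1 < \dots < t_{n+1}$ be real numbers, and let $C = C(n+2,3)$ be the convex hull in $\mathbb{R}^3$ of the points $\mu(t_i) = (t_i, t_i^2, t_i^3)$; its vertices are labelled $0,1,\dots,n+1$. For $S \subseteq \{0,\dots,n+1\}$ write $\operatorname{conv}(S)$ for the convex hull of the points $\mu(t_i)$, $i \in S$. A triangulation of $C$ is a set $T$ of $4$-element subsets of $\{0,\dots,n+1\}$ such that $\bigcup_{S\in T}\operatorname{conv}(S) = C$ and such that for all $S,S'\in T$ the simplices $\operatorname{conv}(S)$ and $\operatorname{conv}(S')$ intersect in a common (possibly empty) face. Let $\Gamma(T)$ be the graph with vertex set $\{1,\dots,n\}$ in which distinct $i,j$ are adjacent if and only if $\{i,j\}\subseteq S$ for some $S\in T$. For vertices $v_1<v_2<v_3<v_4<v_5$ of $C$ put $$T_* = \{\{v_1,v_2,v_4,v_5\},\{v_1,v_2,v_3,v_4\},\{v_2,v_3,v_4,v_5\}\},\qquad T^* = \{\{v_1,v_2,v_3,v_5\},\{v_1,v_3,v_4,v_5\}\}.$$ A triangulation $T'$ of $C$ is obtained from a triangulation $T$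 of $C$ by a bistellar up-flip if, for some such $v_1<\dots<v_5$, $T_*\subseteq T$ and $T' = (T\setminus T_*)\cup T^*$. Write $T\le_1 T'$ if $T'$ is obtained from $T$ by a finite (possibly empty) sequence of bistellar up-flips (the first Stasheff–Tamari order). **Theorem.** Let $T,T'$ be triangulations of $C$. Then $T'$ is obtained from $T$ by a bistellar up-flip if and only if $E(\Gamma(T)) = E(\Gamma(T'))\cup\{e\}$ for some edge $e\in E(\Gamma(T))\setminus E(\Gamma(T'))$. Moreover, $T\le_1 T'$ if and only if $\Gamma(T)\supseteq\Gamma(T')$, that is, $\Gamma(T')$ is a subgraph of $\Gamma(T)$. -/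

import Mathlib

/-- The `d`-dimensional moment curve `s ↦ (s, s², …, s^d)`. -/
def momentCurve (d : ℕ) (s : ℝ) : Fin d → ℝ := fun i => s ^ ((i : ℕ) + 1)

/-- The convex hull of the points of the moment curve in `ℝ³` whose parameters are the `t i` with
`i ∈ S`: the geometric realization of the combinatorial simplex `S`. -/
def momentHull {m : ℕ} (t : Fin m → ℝ) (S : Finset (Fin m)) : Set (Fin 3 → ℝ) :=
  convexHull ℝ ((fun i => momentCurve 3 (t i)) '' (S : Set (Fin m)))

/-- The cyclic polytope `C(m,3)` with vertices at the parameters `t 0, …, t (m-1)`. -/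
def cyclicPolytope {m : ℕ} (t : Fin m → ℝ) : Set (Fin 3 → ℝ) :=
  convexHull ℝ (Set.range fun i => momentCurve 3 (t i))

/-- A triangulation of the cyclic polytope: a collection of tetrahedra, given by their vertex sets,
which cover the polytope and any two of which meet in a common, possibly empty, face. The faces of
a tetrahedron correspond to the subsets of its vertex set. -/
structure CyclicTriangulation {m : ℕ} (t : Fin m → ℝ) where
  simplices : Finset (Finset (Fin m))
  card_eq : ∀ S ∈ simplices, S.card = 4
  union_eq : ⋃ S ∈ simplices, momentHull t S = cyclicPolytope t
  inter_face : ∀ S ∈ simplices, ∀ S' ∈ simplices,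
    ∃ F : Finset (Fin m), F ⊆ S ∧ F ⊆ S' ∧ momentHull t S ∩ momentHull t S' = momentHull t F

/-- The lower triangulation of the cyclic polytope on five vertices. -/
def lowerFlip {m : ℕ} (v : Fin 5 → Fin m) : Finset (Finset (Fin m)) :=
  {{v 0, v 1, v 3, v 4}, {v 0, v 1, v 2, v 3}, {v 1, v 2, v 3, v 4}}

/-- The upper triangulation of the cyclic polytope on five vertices. -/
def upperFlip {m : ℕ} (v : Fin 5 → Fin m) : Finset (Finset (Fin m)) :=
  {{v 0, v 1, v 2, v 4}, {v 0, v 2, v 3, v 4}}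

/-- `T'` is obtained from `T` by a bistellar up-flip on five vertices `v 0 < v 1 < ⋯ < v 4`. -/
def IsUpFlip {m : ℕ} {t : Fin m → ℝ} (T T' : CyclicTriangulation t) : Prop :=
  ∃ v : Fin 5 → Fin m, StrictMono v ∧ lowerFlip v ⊆ T.simplices ∧
    T'.simplices = (T.simplices \ lowerFlip v) ∪ upperFlip v

/-- The first Stasheff–Tamari order: `T'` is obtained from `T` by a finite, possibly empty, sequence
of bistellar up-flips. -/
def StasheffTamariLE {m : ℕ} {t : Fin m → ℝ} (T T' : CyclicTriangulation t) : Prop :=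
  Relation.ReflTransGen IsUpFlip T T'

/-- The vertices `0, …, n+1` of the polytope other than `0` and `n+1` are enumerated by `Fin n`. -/
def innerVertex {n : ℕ} (i : Fin n) : Fin (n + 2) := i.succ.castSucc

/-- The graph `Γ(T)`: the 1-skeleton of the triangulation `T` of `C(n+2,3)`, restricted to the
vertices `1, …, n`. -/
def skeletonGraph {n : ℕ} {t : Fin (n + 2) → ℝ} (T : CyclicTriangulation t) :
    SimpleGraph (Fin n) where
  Adj i j := i ≠ j ∧ ∃ S ∈ T.simplices, innerVertex i ∈ S ∧ innerVertex j ∈ S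
  symm := ⟨fun _ _ ⟨hne, S, hS, hi, hj⟩ => ⟨hne.symm, S, hS, hj, hi⟩⟩
  loopless := ⟨fun _ h => h.1 rfl⟩

/-! A nonzero weight that annihilates all cubics at the nodes changes sign at least four times.
Hence a point has the same barycentric coordinates in two simplices that do not cross
(`IsConvexWeight.eq_of_not_crossing`), and the simplices of a triangulation never cross: no edge `c
d` pierces a triangle `p q r` with `p < c < q < d < r`. Conversely, a four-set whose pairs are edges
and whose triangles are not pierced is a simplex, so a triangulation is determined by its edges
(`eq_of_edge_iff`). Pairs containing the first or last vertex are always edges, so `Γ` already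
carries this information.

The edge relation is persistent (`isPersistent_edge`): edges `a c`, `b d` with `a < b < c < d` force
`a d`, and an edge `a c` passing over a vertex has a support `s`, with `a s` and `s c` edges. An
up-flip deletes exactly the edge `v 1, v 3` (`edge_flip_iff`), which gives both forward
implications.

For the converses, let the edges `E` of `T` properly contain the edges `E'` of `T'`. Then
`IsPersistent.exists_removable` finds an edge `a b` outside `E'` that is not forced by crossing
edges and is not the sole support piece of a longer edge `x b` or `a z`. By
`IsPersistent.exists_isFlippable` it is the diagonal of a double tetrahedron, and flipping there
(`exists_flip`) removes only `a b`, so the new triangulation still contains `E'`. Iteration reaches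
`T'`. -/

open Finset

/-! ### Barycentric weights, affine dependences on the moment curve, and crossings -/

section Weights

variable {m : ℕ}

/-- Nonnegative weights of total mass one that vanish outside `S`. -/
structure IsConvexWeight (S : Finset (Fin m)) (w : Fin m → ℝ) : Prop where
  nonneg : ∀ i, 0 ≤ w i
  eq_zero : ∀ i, i ∉ S → w i = 0
  sum_eq : ∑ i, w i = 1

/-- The combination of the points `momentCurve 3 (t i)` with coefficients `w i`. -/
def momentSum (t : Fin m → ℝ) (w : Fin m → ℝ) : Fin 3 → ℝ :=
  ∑ i, w i • momentCurve 3 (t i)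

/-- `w` annihilates all polynomials of degree at most three at the nodes `t i`. -/
def IsMomentDependence (t : Fin m → ℝ) (w : Fin m → ℝ) : Prop :=
  ∀ k < 4, ∑ i, w i * t i ^ k = 0

/-- An edge of `C` crosses a triangle of `A`: they form an alternating pair on five vertices. -/
def Crossing (C A : Finset (Fin m)) : Prop :=
  ∃ p c q d r, p < c ∧ c < q ∧ q < d ∧ d < r ∧ c ∈ C ∧ d ∈ C ∧ p ∈ A ∧ q ∈ A ∧ r ∈ A

theorem Crossing.mono {C C' A A' : Finset (Fin m)} (h : Crossing C A) (hC : C ⊆ C')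
    (hA : A ⊆ A') : Crossing C' A' := by
  obtain ⟨p, c, q, d, r, h1, h2, h3, h4, hc, hd, hp, hq, hr⟩ := h
  exact ⟨p, c, q, d, r, h1, h2, h3, h4, hC hc, hC hd, hA hp, hA hq, hA hr⟩

theorem five_le_card_of_lt {S : Finset (Fin m)} {p c q d r : Fin m} (h1 : p < c) (h2 : c < q)
    (h3 : q < d) (h4 : d < r) (hp : p ∈ S) (hc : c ∈ S) (hq : q ∈ S) (hd : d ∈ S) (hr : r ∈ S) :
    5 ≤ S.card := by
  have hsub : ({p, c, q, d, r} : Finset (Fin m)) ⊆ S := by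
    intro i hi
    simp only [mem_insert, mem_singleton] at hi
    rcases hi with rfl | rfl | rfl | rfl | rfl <;> assumption
  have hcard : ({p, c, q, d, r} : Finset (Fin m)).card = 5 := by
    rw [card_insert_of_notMem, card_insert_of_notMem, card_insert_of_notMem, card_insert_of_notMem,
      card_singleton] <;> simp only [mem_insert, mem_singleton] <;> omega
  exact hcard ▸ card_le_card hsub

theorem not_crossing_self {S : Finset (Fin m)} (hS : S.card ≤ 4) : ¬ Crossing S S := by
  rintro ⟨p, c, q, d, r, h1, h2, h3, h4, hc, hd, hp, hq, hr⟩
  have := five_le_card_of_lt h1 h2 h3 h4 hp hc hq hd hr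
  omega

theorem momentHull_mono (t : Fin m → ℝ) {F S : Finset (Fin m)} (h : F ⊆ S) :
    momentHull t F ⊆ momentHull t S :=
  convexHull_mono (Set.image_mono (by exact_mod_cast h))

theorem momentHull_univ (t : Fin m → ℝ) : momentHull t univ = cyclicPolytope t := by
  simp [momentHull, cyclicPolytope]

theorem IsConvexWeight.mono {F S : Finset (Fin m)} {w : Fin m → ℝ} (h : IsConvexWeight F w)
    (hFS : F ⊆ S) : IsConvexWeight S w :=
  ⟨h.nonneg, fun i hi => h.eq_zero i fun h' => hi (hFS h'), h.sum_eq⟩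

theorem mem_momentHull {t : Fin m → ℝ} {S : Finset (Fin m)} {x : Fin 3 → ℝ} :
    x ∈ momentHull t S ↔ ∃ w, IsConvexWeight S w ∧ momentSum t w = x := by
  constructor
  · intro hx
    have hconv : Convex ℝ {x | ∃ w, IsConvexWeight S w ∧ momentSum t w = x} := by
      rintro _ ⟨u, hu, rfl⟩ _ ⟨w, hw, rfl⟩ a b ha hb hab
      refine ⟨fun i => a * u i + b * w i, ⟨fun i => ?_, fun i hi => ?_, ?_⟩, ?_⟩
      · exact add_nonneg (mul_nonneg ha (hu.nonneg i)) (mul_nonneg hb (hw.nonneg i))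
      · simp [hu.eq_zero i hi, hw.eq_zero i hi]
      · rw [sum_add_distrib, ← mul_sum, ← mul_sum, hu.sum_eq, hw.sum_eq]
        simpa using hab
      · simp only [momentSum, add_smul, sum_add_distrib, mul_smul, smul_sum]
    refine convexHull_min ?_ hconv hx
    rintro _ ⟨i, hi, rfl⟩
    refine ⟨Pi.single i 1, ⟨fun j => ?_, fun j hj => ?_, by simp⟩, ?_⟩
    · by_cases h : j = i
      · subst h; simp
      · simp [h]
    · have : j ≠ i := by rintro rfl; exact hj (by exact_mod_cast hi)
      simp [this]
    · simp [momentSum, Pi.single_apply, ite_smul]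
  · rintro ⟨w, hw, rfl⟩
    have hsum : ∑ i ∈ S, w i = 1 := by
      rw [← hw.sum_eq]
      exact sum_subset (subset_univ _) fun i _ hi => hw.eq_zero i hi
    have hpt : momentSum t w = ∑ i ∈ S, w i • momentCurve 3 (t i) :=
      (sum_subset (subset_univ _) fun i _ hi => by rw [hw.eq_zero i hi, zero_smul]).symm
    rw [hpt]
    exact (convex_convexHull ℝ _).sum_mem (fun i _ => hw.nonneg i) hsum
      fun i hi => subset_convexHull ℝ _ ⟨i, by exact_mod_cast hi, rfl⟩

theorem isMomentDependence_iff {t w : Fin m → ℝ} :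
    IsMomentDependence t w ↔ ∑ i, w i = 0 ∧ momentSum t w = 0 := by
  constructor
  · intro h
    refine ⟨by simpa using h 0 (by norm_num), ?_⟩
    funext k
    simpa [momentSum, momentCurve] using h (k + 1) (by omega)
  · rintro ⟨h0, h1⟩ k hk
    rcases k with _ | k
    · simpa using h0
    · simpa [momentSum, momentCurve] using congrFun h1 ⟨k, by omega⟩

theorem momentSum_add (t u w : Fin m → ℝ) :
    momentSum t (fun i => u i + w i) = momentSum t u + momentSum t w := by
  simp [momentSum, add_smul, sum_add_distrib]

theorem momentSum_smul (t w : Fin m → ℝ) (a : ℝ) :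
    momentSum t (fun i => a * w i) = a • momentSum t w := by
  simp [momentSum, mul_smul, smul_sum]

theorem IsConvexWeight.isMomentDependence {t u w : Fin m → ℝ} {A B : Finset (Fin m)}
    (hu : IsConvexWeight A u) (hw : IsConvexWeight B w) (h : momentSum t u = momentSum t w) :
    IsMomentDependence t (fun i => u i - w i) := by
  rw [isMomentDependence_iff]
  refine ⟨by rw [sum_sub_distrib, hu.sum_eq, hw.sum_eq, sub_self], ?_⟩
  have : momentSum t (fun i => u i - w i) = momentSum t u - momentSum t w := by
    simp [momentSum, sub_smul, sum_sub_distrib]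
  rw [this, h, sub_self]

theorem exists_first {P : Fin m → Prop} (h : ∃ i, P i) : ∃ i, P i ∧ ∀ j < i, ¬ P j := by
  obtain ⟨i, hi, hmin⟩ := wellFounded_lt.has_min {i | P i} h
  exact ⟨i, hi, fun j hj hP => hmin j hP hj⟩

theorem exists_last {P : Fin m → Prop} (h : ∃ i, P i) : ∃ i, P i ∧ ∀ j > i, ¬ P j := by
  obtain ⟨i, hi, hmin⟩ := wellFounded_gt.has_min {i | P i} h
  exact ⟨i, hi, fun j hj hP => hmin j hP hj⟩

theorem IsMomentDependence.sum_cubic {t w : Fin m → ℝ} (h : IsMomentDependence t w)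
    (a b c d : ℝ) : ∑ i, w i * (a + b * t i + c * t i ^ 2 + d * t i ^ 3) = 0 := by
  have h0 := h 0 (by norm_num)
  have h1 := h 1 (by norm_num)
  have h2 := h 2 (by norm_num)
  have h3 := h 3 (by norm_num)
  calc _ = a * ∑ i, w i * t i ^ 0 + b * ∑ i, w i * t i ^ 1 + c * ∑ i, w i * t i ^ 2
        + d * ∑ i, w i * t i ^ 3 := by
        simp only [mul_sum, ← sum_add_distrib]
        exact sum_congr rfl fun i _ => by ring
    _ = 0 := by rw [h0, h1, h2, h3]; ring

theorem IsMomentDependence.false_of_nonneg {t w : Fin m → ℝ} (h : IsMomentDependence t w)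
    {f : ℝ → ℝ} {a b c d : ℝ} (hf : ∀ x, f x = a + b * x + c * x ^ 2 + d * x ^ 3)
    (hnonneg : ∀ i, 0 ≤ w i * f (t i)) {i₀ : Fin m} (hpos : 0 < w i₀ * f (t i₀)) : False := by
  have := h.sum_cubic a b c d
  simp only [← hf] at this
  have := (sum_eq_zero_iff_of_nonneg fun i _ => hnonneg i).1 this i₀ (mem_univ _)
  linarith

theorem IsMomentDependence.neg {t w : Fin m → ℝ} (h : IsMomentDependence t w) :
    IsMomentDependence t (fun i => - w i) := by
  intro k hk
  simpa using h k hk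

/-- With fewer than four sign changes, a polynomial of degree at most three with roots at the
sign-change nodes found so far would agree in sign with `w` at every node, so its pairing with `w`
would be positive instead of zero. Each further sign change rules out one more degree. -/
theorem IsMomentDependence.exists_alternating_of_first_pos {t w : Fin m → ℝ} (ht : StrictMono t)
    (h : IsMomentDependence t w) {p : Fin m} (hp : 0 < w p) (hfirst : ∀ i < p, w i = 0) :
    ∃ c q d r, p < c ∧ c < q ∧ q < d ∧ d < r ∧ w c < 0 ∧ 0 < w q ∧ w d < 0 ∧ 0 < w r := by
  have hex : ∃ c, p < c ∧ w c < 0 := by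
    by_contra! hno
    refine h.false_of_nonneg (f := fun _ => 1) (a := 1) (b := 0) (c := 0) (d := 0)
      (fun x => by ring) (fun i => ?_) (i₀ := p) (by simpa using hp)
    rcases lt_trichotomy i p with hi | rfl | hi
    · simp [hfirst i hi]
    · simpa using hp.le
    · simpa using hno i hi
  obtain ⟨c, ⟨hpc, hc⟩, hcmin⟩ := exists_first hex
  have hfirst' : ∀ i < c, 0 ≤ w i := fun i hi => by
    rcases lt_trichotomy i p with hip | rfl | hip
    · exact (hfirst i hip).ge
    · exact hp.le
    · exact not_lt.1 fun hw => hcmin i hi ⟨hip, hw⟩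
  have hex : ∃ q, c < q ∧ 0 < w q := by
    by_contra! hno
    refine h.false_of_nonneg (f := fun x => t c - x) (a := t c) (b := -1) (c := 0) (d := 0)
      (fun x => by ring) (fun i => ?_) (i₀ := p) (mul_pos hp (sub_pos.2 (ht hpc)))
    rcases lt_trichotomy i c with hi | rfl | hi
    · exact mul_nonneg (hfirst' i hi) (sub_nonneg.2 (ht hi).le)
    · simp
    · exact mul_nonneg_of_nonpos_of_nonpos (hno i hi) (sub_nonpos.2 (ht hi).le)
  obtain ⟨q, ⟨hcq, hq⟩, hqmin⟩ := exists_first hex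
  have hcq' : ∀ i, c < i → i < q → w i ≤ 0 := fun i hi hi' =>
    not_lt.1 fun hw => hqmin i hi' ⟨hi, hw⟩
  have hex : ∃ d, q < d ∧ w d < 0 := by
    by_contra! hno
    refine h.false_of_nonneg (f := fun x => (t c - x) * (t q - x)) (a := t c * t q)
      (b := - t c - t q) (c := 1) (d := 0) (fun x => by ring) (fun i => ?_) (i₀ := p)
      (mul_pos hp (mul_pos (sub_pos.2 (ht hpc)) (sub_pos.2 (ht (hpc.trans hcq)))))
    rcases lt_trichotomy i c with hi | rfl | hi
    · exact mul_nonneg (hfirst' i hi) (mul_nonneg (sub_nonneg.2 (ht hi).le)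
        (sub_nonneg.2 (ht (hi.trans hcq)).le))
    · simp
    · rcases lt_trichotomy i q with hi' | rfl | hi'
      · exact mul_nonneg_of_nonpos_of_nonpos (hcq' i hi hi')
          (mul_nonpos_of_nonpos_of_nonneg (sub_nonpos.2 (ht hi).le) (sub_nonneg.2 (ht hi').le))
      · simp
      · exact mul_nonneg (hno i hi') (mul_nonneg_of_nonpos_of_nonpos (sub_nonpos.2 (ht hi).le)
          (sub_nonpos.2 (ht hi').le))
  obtain ⟨d, ⟨hqd, hd⟩, hdmin⟩ := exists_first hex
  have hqd' : ∀ i, q < i → i < d → 0 ≤ w i := fun i hi hi' =>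
    not_lt.1 fun hw => hdmin i hi' ⟨hi, hw⟩
  have hex : ∃ r, d < r ∧ 0 < w r := by
    by_contra! hno
    refine h.false_of_nonneg (f := fun x => (t c - x) * (t q - x) * (t d - x))
      (a := t c * t q * t d) (b := - t c * t q - t c * t d - t q * t d) (c := t c + t q + t d)
      (d := -1) (fun x => by ring) (fun i => ?_) (i₀ := p)
      (mul_pos hp (mul_pos (mul_pos (sub_pos.2 (ht hpc)) (sub_pos.2 (ht (hpc.trans hcq))))
        (sub_pos.2 (ht (hpc.trans (hcq.trans hqd))))))
    rcases lt_trichotomy i c with hi | rfl | hi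
    · exact mul_nonneg (hfirst' i hi) (mul_nonneg (mul_nonneg (sub_nonneg.2 (ht hi).le)
        (sub_nonneg.2 (ht (hi.trans hcq)).le)) (sub_nonneg.2 (ht (hi.trans (hcq.trans hqd))).le))
    · simp
    · rcases lt_trichotomy i q with hi' | rfl | hi'
      · exact mul_nonneg_of_nonpos_of_nonpos (hcq' i hi hi')
          (mul_nonpos_of_nonpos_of_nonneg (mul_nonpos_of_nonpos_of_nonneg
            (sub_nonpos.2 (ht hi).le) (sub_nonneg.2 (ht hi').le))
            (sub_nonneg.2 (ht (hi'.trans hqd)).le))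
      · simp
      · have hpos := mul_nonneg_of_nonpos_of_nonpos (sub_nonpos.2 (ht hi).le)
          (sub_nonpos.2 (ht hi').le)
        rcases lt_trichotomy i d with hi'' | rfl | hi''
        · exact mul_nonneg (hqd' i hi' hi'') (mul_nonneg hpos (sub_nonneg.2 (ht hi'').le))
        · simp
        · exact mul_nonneg_of_nonpos_of_nonpos (hno i hi'')
            (mul_nonpos_of_nonneg_of_nonpos hpos (sub_nonpos.2 (ht hi'').le))
  obtain ⟨r, hdr, hr⟩ := hex
  exact ⟨c, q, d, r, hpc, hcq, hqd, hdr, hc, hq, hd, hr⟩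

theorem IsMomentDependence.exists_alternating {t w : Fin m → ℝ} (ht : StrictMono t)
    (h : IsMomentDependence t w) (hw : ∃ i, w i ≠ 0) :
    ∃ p c q d r, p < c ∧ c < q ∧ q < d ∧ d < r ∧
      ((0 < w p ∧ w c < 0 ∧ 0 < w q ∧ w d < 0 ∧ 0 < w r) ∨
        (w p < 0 ∧ 0 < w c ∧ w q < 0 ∧ 0 < w d ∧ w r < 0)) := by
  obtain ⟨p, hp, hmin⟩ := exists_first hw
  rcases lt_or_gt_of_ne hp with hneg | hpos
  · obtain ⟨c, q, d, r, h1, h2, h3, h4, h5, h6, h7, h8⟩ :=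
      h.neg.exists_alternating_of_first_pos ht (p := p) (by simpa using hneg)
        fun i hi => by simpa using hmin i hi
    exact ⟨p, c, q, d, r, h1, h2, h3, h4, Or.inr ⟨hneg, by simpa using h5, by simpa using h6,
      by simpa using h7, by simpa using h8⟩⟩
  · obtain ⟨c, q, d, r, h1, h2, h3, h4, h5, h6, h7, h8⟩ :=
      h.exists_alternating_of_first_pos ht hpos fun i hi => by simpa using hmin i hi
    exact ⟨p, c, q, d, r, h1, h2, h3, h4, Or.inl ⟨hpos, h5, h6, h7, h8⟩⟩

/-- A point in two simplices that do not cross has the same barycentric coordinates in both. -/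
theorem IsConvexWeight.eq_of_not_crossing {t u w : Fin m → ℝ} (ht : StrictMono t)
    {A B : Finset (Fin m)} (hu : IsConvexWeight A u) (hw : IsConvexWeight B w)
    (h : momentSum t u = momentSum t w) (hAB : ¬ Crossing A B) (hBA : ¬ Crossing B A) :
    u = w := by
  by_contra hne
  obtain ⟨i, hi⟩ := Function.ne_iff.1 hne
  have hA : ∀ {i}, 0 < u i - w i → i ∈ A := fun {i} hi => by
    by_contra hiA
    have := hu.eq_zero i hiA
    have := hw.nonneg i
    linarith
  have hB : ∀ {i}, u i - w i < 0 → i ∈ B := fun {i} hi => by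
    by_contra hiB
    have := hw.eq_zero i hiB
    have := hu.nonneg i
    linarith
  -- Positive entries of `u - w` lie in `A` and negative ones in `B`, so an alternation of length
  -- five is a crossing.
  obtain ⟨p, c, q, d, r, h1, h2, h3, h4, ⟨hp, hc, hq, hd, hr⟩ | ⟨hp, hc, hq, hd, hr⟩⟩ :=
    (hu.isMomentDependence hw h).exists_alternating ht ⟨i, sub_ne_zero.2 hi⟩
  · exact hBA ⟨p, c, q, d, r, h1, h2, h3, h4, hB hc, hB hd, hA hp, hA hq, hA hr⟩
  · exact hAB ⟨p, c, q, d, r, h1, h2, h3, h4, hA hc, hA hd, hB hp, hB hq, hB hr⟩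

theorem momentHull_inter_of_not_crossing {t : Fin m → ℝ} (ht : StrictMono t)
    {A B : Finset (Fin m)} (hAB : ¬ Crossing A B) (hBA : ¬ Crossing B A) :
    momentHull t A ∩ momentHull t B = momentHull t (A ∩ B) := by
  refine Set.Subset.antisymm ?_ (Set.subset_inter (momentHull_mono t inter_subset_left)
    (momentHull_mono t inter_subset_right))
  rintro x ⟨hxA, hxB⟩
  obtain ⟨u, hu, rfl⟩ := mem_momentHull.1 hxA
  obtain ⟨w, hw, hx⟩ := mem_momentHull.1 hxB
  obtain rfl := hu.eq_of_not_crossing ht hw hx.symm hAB hBA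
  refine mem_momentHull.2 ⟨u, ⟨hu.nonneg, fun i hi => ?_, hu.sum_eq⟩, rfl⟩
  by_cases hiA : i ∈ A
  · exact hw.eq_zero i fun hiB => hi (mem_inter.2 ⟨hiA, hiB⟩)
  · exact hu.eq_zero i hiA

/-- The Radon dependence of five points on the moment curve. -/
theorem exists_radon {t : Fin m → ℝ} (ht : StrictMono t) {v : Fin 5 → Fin m} (hv : StrictMono v) :
    ∃ w, IsMomentDependence t w ∧ (∀ i, (∀ j, v j ≠ i) → w i = 0) ∧ 0 < w (v 0) ∧ w (v 1) < 0 ∧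
      0 < w (v 2) ∧ w (v 3) < 0 ∧ 0 < w (v 4) := by
  have hdep : ¬ LinearIndependent ℝ (fun (j : Fin 5) (k : Fin 4) => t (v j) ^ (k : ℕ)) := by
    intro hli
    have := hli.fintype_card_le_finrank
    simp at this
  obtain ⟨g, hg, hne⟩ := Fintype.not_linearIndependent_iff.1 hdep
  have hgd : IsMomentDependence (t ∘ v) g := by
    intro k hk
    simpa using congrFun hg ⟨k, hk⟩
  obtain ⟨g, hgd, h0, h1, h2, h3, h4⟩ : ∃ g, IsMomentDependence (t ∘ v) g ∧ 0 < g 0 ∧ g 1 < 0 ∧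
      0 < g 2 ∧ g 3 < 0 ∧ 0 < g 4 := by
    obtain ⟨p, c, q, d, r, hpc, hcq, hqd, hdr, h⟩ := hgd.exists_alternating (ht.comp hv) hne
    -- An increasing chain of five indices in `Fin 5` uses all of them.
    obtain rfl : p = 0 := by omega
    obtain rfl : c = 1 := by omega
    obtain rfl : q = 2 := by omega
    obtain rfl : d = 3 := by omega
    obtain rfl : r = 4 := by omega
    rcases h with h | h
    · exact ⟨g, hgd, h⟩
    · exact ⟨fun i => - g i, hgd.neg, by simpa using h⟩
  have hext : ∀ j, Function.extend v g 0 (v j) = g j := hv.injective.extend_apply g 0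
  refine ⟨Function.extend v g 0, fun k hk => ?_, fun i hi => ?_, ?_⟩
  · rw [← hgd k hk]
    refine (Fintype.sum_of_injective v hv.injective _ _ (fun i hi => ?_) fun j => ?_).symm
    · rw [Function.extend_apply' _ _ _ fun ⟨j, hj⟩ => hi ⟨j, hj⟩]
      simp
    · simp [hext]
  · rw [Function.extend_apply' _ _ _ fun ⟨j, hj⟩ => hi j hj]
    rfl
  · simpa only [hext] using ⟨h0, h1, h2, h3, h4⟩

end Weights

/-! ### Persistent graphs: removable and flippable edges -/

section Persistent

variable {m : ℕ}

/-- A persistent graph on `Fin m`, as a relation that is only relevant for `i < j`, in which the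
first and the last vertex are joined to all others. -/
structure IsPersistent (E : Fin m → Fin m → Prop) : Prop where
  trans_cross : ∀ {a b c d}, a < b → b < c → c < d → E a c → E b d → E a d
  bar : ∀ {a b c}, a < b → b < c → E a c → ∃ s, a < s ∧ s < c ∧ E a s ∧ E s c
  consecutive : ∀ {a b}, a < b → (∀ s, a < s → b ≤ s) → E a b
  first : ∀ {a b}, (∀ s, a ≤ s) → a < b → E a b
  last : ∀ {a b}, (∀ s, s ≤ b) → a < b → E a b

/-- No crossing pair of edges of `E` forces the edge `a b` to be present. -/
def Unforced (E : Fin m → Fin m → Prop) (a b : Fin m) : Prop :=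
  ∀ p q, a < p → p < q → q < b → E a q → E p b → False

/-- The mirror image of a relation on `Fin m`. -/
def mirror (E : Fin m → Fin m → Prop) (i j : Fin m) : Prop := E j.rev i.rev

theorem IsPersistent.mirror {E : Fin m → Fin m → Prop} (h : IsPersistent E) :
    IsPersistent (mirror E) where
  trans_cross hab hbc hcd hac hbd :=
    h.trans_cross (Fin.rev_lt_rev.2 hcd) (Fin.rev_lt_rev.2 hbc) (Fin.rev_lt_rev.2 hab) hbd hac
  bar hab hbc hac := by
    obtain ⟨s, h1, h2, h3, h4⟩ := h.bar (Fin.rev_lt_rev.2 hbc) (Fin.rev_lt_rev.2 hab) hac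
    refine ⟨s.rev, Fin.lt_rev_iff.2 h2, Fin.rev_lt_iff.2 h1, ?_, ?_⟩
    · simpa [_root_.mirror] using h4
    · simpa [_root_.mirror] using h3
  consecutive {a b} hab hs := h.consecutive (Fin.rev_lt_rev.2 hab) fun s hbs => by
    by_contra! hsa
    exact absurd (hs s.rev (Fin.lt_rev_iff.2 hsa)) (not_le.2 (Fin.rev_lt_iff.2 hbs))
  first {a b} ha hab := h.last (fun s => by rw [Fin.le_rev_iff]; exact ha _) (Fin.rev_lt_rev.2 hab)
  last {a b} hb hab := h.first (fun s => by rw [Fin.rev_le_iff]; exact hb _) (Fin.rev_lt_rev.2 hab)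

theorem Unforced.mirror {E : Fin m → Fin m → Prop} {a b : Fin m} (h : Unforced E a b) :
    Unforced (mirror E) b.rev a.rev := by
  intro p q h1 h2 h3 h4 h5
  refine h q.rev p.rev (Fin.lt_rev_iff.2 h3) (Fin.rev_lt_rev.2 h2) (Fin.rev_lt_iff.2 h1) ?_ ?_
  · simpa [_root_.mirror] using h5
  · simpa [_root_.mirror] using h4

theorem Unforced.of_mirror {E : Fin m → Fin m → Prop} {a b : Fin m}
    (h : Unforced (_root_.mirror E) b.rev a.rev) : Unforced E a b := by
  intro p q h1 h2 h3 h4 h5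
  refine h q.rev p.rev (Fin.rev_lt_rev.2 h3) (Fin.rev_lt_rev.2 h2) (Fin.rev_lt_rev.2 h1) ?_ ?_
  · simpa [_root_.mirror] using h5
  · simpa [_root_.mirror] using h4

/-- If the unforced edge `a b` is the only support of `x b`, then `x b` is unforced as well. -/
theorem IsPersistent.unforced_of_sole_support {E : Fin m → Fin m → Prop} (h : IsPersistent E)
    {x a b : Fin m} (hxa : x < a) (hab : a < b) (hE : E a b) (hun : Unforced E a b)
    (hsole : ∀ s, x < s → s < b → E x s → E s b → s = a) : Unforced E x b := by
  intro p q₀ hxp hpq₀ hqb₀ hxq₀ hpb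
  -- With `q` the nearest neighbour of `x` beyond `p`, a support `r` of `x q` satisfies `r ≤ p`.
  -- Then `r` supports `x b` too, so `r = a` and `a q` is an edge.
  obtain ⟨q, ⟨hpq, hqb, hxq⟩, hqmin⟩ :=
    exists_first (P := fun q => p < q ∧ q < b ∧ E x q) ⟨q₀, hpq₀, hqb₀, hxq₀⟩
  obtain ⟨r, hxr, hrq, hxr', hrq'⟩ := h.bar hxp hpq hxq
  have hrp : r ≤ p := not_lt.1 fun hpr => hqmin r hrq ⟨hpr, hrq.trans hqb, hxr'⟩
  have hra : r = a := by
    rcases hrp.eq_or_lt with rfl | hrp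
    · exact hsole r hxr (hrq.trans hqb) hxr' hpb
    · exact hsole r hxr (hrq.trans hqb) hxr' (h.trans_cross hrp hpq hqb hrq' hpb)
  subst hra
  rcases hrp.eq_or_lt with rfl | hrp
  -- Here `p = a`. A support `c` of `a b` either makes `a q` and `c b` force `a b`, or becomes a
  -- second support of `x b`.
  · obtain ⟨c, hac, hcb, hac', hcb'⟩ := h.bar hrq hqb hE
    rcases lt_trichotomy c q with hcq | rfl | hqc
    · exact hun c q hac hcq hqb hrq' hcb'
    · exact hac.ne' (hsole c (hxa.trans hac) hcb hxq hcb')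
    · exact hac.ne' (hsole c (hxa.trans hac) hcb (h.trans_cross hxa hrq hqc hxq hac') hcb')
  · exact hun p q hrp hpq hqb hrq' hpb

/-- If `E` properly contains `E'`, then some edge outside `E'` can be removed from `E`. -/
theorem IsPersistent.exists_removable {E E' : Fin m → Fin m → Prop} (h : IsPersistent E)
    (h' : IsPersistent E') (hle : ∀ a b, a < b → E' a b → E a b)
    (hne : ∃ a b, a < b ∧ E a b ∧ ¬ E' a b) :
    ∃ a b, a < b ∧ E a b ∧ ¬ E' a b ∧ Unforced E a b ∧
      (∀ x < a, E x b → ∃ s, x < s ∧ s < b ∧ s ≠ a ∧ E x s ∧ E s b) ∧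
      (∀ z > b, E a z → ∃ s, a < s ∧ s < z ∧ s ≠ b ∧ E a s ∧ E s z) := by
  -- A shortest edge of `E` outside `E'` is unforced: two edges forcing it are shorter, hence in
  -- `E'`, and would force it in `E'`.
  have hun : ∃ e : Fin m × Fin m, e.1 < e.2 ∧ E e.1 e.2 ∧ ¬ E' e.1 e.2 ∧ Unforced E e.1 e.2 := by
    obtain ⟨a₀, b₀, hab₀⟩ := hne
    obtain ⟨⟨a, b⟩, ⟨hab, hE, hE'⟩, hmin⟩ := (measure fun e : Fin m × Fin m =>
      (e.2 : ℕ) - e.1).wf.has_min {e | e.1 < e.2 ∧ E e.1 e.2 ∧ ¬ E' e.1 e.2} ⟨(a₀, b₀), hab₀⟩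
    refine ⟨(a, b), hab, hE, hE', fun p q hap hpq hqb haq hpb => ?_⟩
    dsimp only at hap hqb haq hpb hab hE hE'
    by_cases haq' : E' a q
    · by_cases hpb' : E' p b
      · exact hE' (h'.trans_cross hap hpq hqb haq' hpb')
      · refine hmin (p, b) ⟨hpq.trans hqb, hpb, hpb'⟩ ?_
        show (b : ℕ) - p < b - a
        omega
    · refine hmin (a, q) ⟨hap.trans hpq, haq, haq'⟩ ?_
      show (q : ℕ) - a < b - a
      omega
  -- Now take a longest unforced edge outside `E'`. If `a` were the only support of `x b`, then `x
  -- b` would be unforced, and outside `E'` because its support there would need `a b`; but it is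
  -- longer.
  obtain ⟨⟨a, b⟩, ⟨hab, hE, hE', hun⟩, hmax⟩ := (measure fun e : Fin m × Fin m =>
      m - ((e.2 : ℕ) - e.1)).wf.has_min
        {e | e.1 < e.2 ∧ E e.1 e.2 ∧ ¬ E' e.1 e.2 ∧ Unforced E e.1 e.2} hun
  dsimp only at hab hE hE' hun
  refine ⟨a, b, hab, hE, hE', hun, fun x hxa hxb => ?_, fun z hbz haz => ?_⟩
  · by_contra! hno
    have hsole : ∀ s, x < s → s < b → E x s → E s b → s = a := fun s h1 h2 h3 h4 => by
      by_contra hsa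
      exact hno s h1 h2 hsa h3 h4
    have hxb' : ¬ E' x b := fun hxb' => by
      obtain ⟨s, h1, h2, h3, h4⟩ := h'.bar hxa hab hxb'
      obtain rfl := hsole s h1 h2 (hle _ _ h1 h3) (hle _ _ h2 h4)
      exact hE' h4
    refine hmax (x, b) ⟨hxa.trans hab, hxb, hxb',
      h.unforced_of_sole_support hxa hab hE hun hsole⟩ ?_
    show m - ((b : ℕ) - x) < m - (b - a)
    omega
  · by_contra! hno
    have hsole : ∀ s, a < s → s < z → E a s → E s z → s = b := fun s h1 h2 h3 h4 => by
      by_contra hsb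
      exact hno s h1 h2 hsb h3 h4
    have haz' : ¬ E' a z := fun haz' => by
      obtain ⟨s, h1, h2, h3, h4⟩ := h'.bar hab hbz haz'
      obtain rfl := hsole s h1 h2 (hle _ _ h1 h3) (hle _ _ h2 h4)
      exact hE' h3
    have hunz : Unforced E a z := by
      refine Unforced.of_mirror (h.mirror.unforced_of_sole_support (Fin.rev_lt_rev.2 hbz)
        (Fin.rev_lt_rev.2 hab) (by simpa [_root_.mirror] using hE) hun.mirror
        fun s h1 h2 h3 h4 => ?_)
      rw [← Fin.rev_eq_iff]
      refine hsole _ (Fin.lt_rev_iff.2 h2) (Fin.rev_lt_iff.2 h1) ?_ ?_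
      · simpa [_root_.mirror] using h4
      · simpa [_root_.mirror] using h3
    refine hmax (a, z) ⟨hab.trans hbz, haz, haz', hunz⟩ ?_
    show m - ((z : ℕ) - a) < m - (b - a)
    omega

/-- The second support of `x b` lies at or beyond `y`, as otherwise `a b` is forced or `hmax` fails.
Descend from it to the nearest neighbour `s ≥ y` of `x`: if `s > y`, a support of `x s` yields the
edge `a s`, which with `y b` forces `a b`. A second descent, from `y` to `a`, gives `x a`. -/
theorem IsPersistent.adj_left {E : Fin m → Fin m → Prop} (h : IsPersistent E)
    {x a y b : Fin m} (hxa : x < a) (hay : a < y) (hyb : y < b) (hab' : E a b) (hay' : E a y)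
    (hyb' : E y b) (hun : Unforced E a b) (hmax : ∀ r, x < r → r < a → ¬ E r b)
    (hsup : ∃ s, x < s ∧ s < b ∧ s ≠ a ∧ E x s ∧ E s b) : E x a ∧ E x y := by
  have hxy : E x y := by
    obtain ⟨s₀, hxs₀, hsb₀, hsa₀, hxs₀', hsb₀'⟩ := hsup
    have has₀ : a < s₀ := by
      rcases lt_or_gt_of_ne hsa₀ with hlt | hlt
      · exact absurd hsb₀' (hmax s₀ hxs₀ hlt)
      · exact hlt
    have hys₀ : y ≤ s₀ := not_lt.1 fun hlt => hun s₀ y has₀ hlt hyb hay' hsb₀'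
    obtain ⟨s, ⟨hys, hsb, hxs⟩, hmin⟩ :=
      exists_first (P := fun s => y ≤ s ∧ s < b ∧ E x s) ⟨s₀, hys₀, hsb₀, hxs₀'⟩
    rcases hys.eq_or_lt with rfl | hys
    · exact hxs
    obtain ⟨r, hxr, hrs, hxr', hrs'⟩ := h.bar hxa (hay.trans hys) hxs
    have hry : r < y := not_le.1 fun hyr => hmin r hrs ⟨hyr, hrs.trans hsb, hxr'⟩
    have has : E a s := by
      rcases lt_trichotomy r a with hra | rfl | har
      · exact absurd (h.trans_cross hra (hay.trans hys) hsb hrs' hab') (hmax r hxr hra)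
      · exact hrs'
      · exact h.trans_cross har hry hys hay' hrs'
    exact (hun y s hay hys hsb has hyb').elim
  refine ⟨?_, hxy⟩
  obtain ⟨s, ⟨has, hsy, hxs⟩, hmin⟩ :=
    exists_first (P := fun s => a ≤ s ∧ s ≤ y ∧ E x s) ⟨y, hay.le, le_rfl, hxy⟩
  rcases has.eq_or_lt with rfl | has
  · exact hxs
  obtain ⟨r, hxr, hrs, hxr', hrs'⟩ := h.bar hxa has hxs
  have hra : r < a := not_le.1 fun har => hmin r hrs ⟨har, hrs.le.trans hsy, hxr'⟩
  exact absurd (h.trans_cross hra has (hsy.trans_lt hyb) hrs' hab') (hmax r hxr hra)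

/-- Among such edges take `c` last, then `d` first. Any support of `c d` gives another such edge, an
edge from `a` into `(b, z)`, or the edge `c b`, each excluded. -/
theorem IsPersistent.not_adj_of_between {E : Fin m → Fin m → Prop} (h : IsPersistent E)
    {x a b z : Fin m} (hab : a < b) (hab' : E a b)
    (hmax : ∀ r, x < r → r < a → ¬ E r b) (hmin : ∀ r, b < r → r < z → ¬ E a r)
    {c d : Fin m} (hxc : x < c) (hca : c < a) (hbd : b < d) (hdz : d < z) : ¬ E c d := by
  intro hcd
  obtain ⟨c, ⟨hxc, hca, d₀, hbd₀, hdz₀, hcd₀⟩, hcmax⟩ := exists_last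
    (P := fun c => x < c ∧ c < a ∧ ∃ d, b < d ∧ d < z ∧ E c d) ⟨c, hxc, hca, d, hbd, hdz, hcd⟩
  obtain ⟨d, ⟨hbd, hdz, hcd⟩, hdmin⟩ := exists_first
    (P := fun d => b < d ∧ d < z ∧ E c d) ⟨d₀, hbd₀, hdz₀, hcd₀⟩
  obtain ⟨r, hcr, hrd, hcr', hrd'⟩ := h.bar hca (hab.trans hbd) hcd
  rcases lt_trichotomy r a with hra | rfl | har
  · exact hcmax r hcr ⟨hxc.trans hcr, hra, d, hbd, hdz, hrd'⟩
  · exact hmin d hbd hdz hrd'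
  rcases lt_trichotomy r b with hrb | rfl | hbr
  · exact hmin d hbd hdz (h.trans_cross har hrb hbd hab' hrd')
  · exact hmax c hxc hca hcr'
  · exact hdmin r hrd ⟨hbr, hrd.trans hdz, hcr'⟩

/-- The edge `a b` is the diagonal of a double tetrahedron `x a y b z` that no other edge enters. -/
structure IsFlippable (E : Fin m → Fin m → Prop) (x a y b z : Fin m) : Prop where
  xa : x < a
  ay : a < y
  yb : y < b
  bz : b < z
  adj : ∀ i ∈ ({x, a, y, b, z} : Finset (Fin m)), ∀ j ∈ ({x, a, y, b, z} : Finset (Fin m)),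
    i < j → E i j
  left : ∀ c d, x < c → c < a → a < d → d < z → ¬ E c d
  right : ∀ c d, x < c → c < b → b < d → d < z → ¬ E c d
  middle : ∀ c d, a ≤ c → c < y → y < d → d ≤ b → E c d → c = a ∧ d = b

/-- The vertex `y` is a support of `a b`, `x` is the last neighbour of `b` before `a`, and `z` the
first neighbour of `a` after `b`; the first and last vertices guarantee that `x` and `z` exist. -/
theorem IsPersistent.exists_isFlippable {E : Fin m → Fin m → Prop} (h : IsPersistent E)
    {a b : Fin m} (hab : a < b) (hE : E a b) (hun : Unforced E a b)
    (hmid : ∃ s, a < s ∧ s < b) (hlt : ∃ s, s < a) (hgt : ∃ s, b < s)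
    (hl : ∀ x < a, E x b → ∃ s, x < s ∧ s < b ∧ s ≠ a ∧ E x s ∧ E s b)
    (hr : ∀ z > b, E a z → ∃ s, a < s ∧ s < z ∧ s ≠ b ∧ E a s ∧ E s z) :
    ∃ x y z, IsFlippable E x a y b z := by
  obtain ⟨s, has, hsb⟩ := hmid
  obtain ⟨y, hay, hyb, hay', hyb'⟩ := h.bar has hsb hE
  obtain ⟨x, ⟨hxa, hxb'⟩, hxmax⟩ : ∃ x, (x < a ∧ E x b) ∧ ∀ r > x, ¬ (r < a ∧ E r b) := by
    obtain ⟨s, hs⟩ := hlt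
    obtain ⟨i, -, hi⟩ := exists_first (P := fun _ : Fin m => True) ⟨s, trivial⟩
    have hi' : ∀ s, i ≤ s := fun s => not_lt.1 fun hlt => hi s hlt trivial
    have hia : i < a := (hi' s).trans_lt hs
    exact exists_last (P := fun x => x < a ∧ E x b) ⟨i, hia, h.first hi' (hia.trans hab)⟩
  obtain ⟨z, ⟨hbz, haz'⟩, hzmin⟩ : ∃ z, (b < z ∧ E a z) ∧ ∀ r < z, ¬ (b < r ∧ E a r) := by
    obtain ⟨s, hs⟩ := hgt
    obtain ⟨i, -, hi⟩ := exists_last (P := fun _ : Fin m => True) ⟨s, trivial⟩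
    have hi' : ∀ s, s ≤ i := fun s => not_lt.1 fun hlt => hi s hlt trivial
    have hbi : b < i := hs.trans_le (hi' s)
    exact exists_first (P := fun z => b < z ∧ E a z) ⟨i, hbi, h.last hi' (hab.trans hbi)⟩
  have hxmax : ∀ r, x < r → r < a → ¬ E r b := fun r h1 h2 h3 => hxmax r h1 ⟨h2, h3⟩
  have hzmin : ∀ r, b < r → r < z → ¬ E a r := fun r h1 h2 h3 => hzmin r h2 ⟨h1, h3⟩
  obtain ⟨hxa', hxy'⟩ := h.adj_left hxa hay hyb hE hay' hyb' hun hxmax (hl x hxa hxb')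
  obtain ⟨hbz', hyz'⟩ : E b z ∧ E y z := by
    have := h.mirror.adj_left (x := z.rev) (a := b.rev) (y := y.rev) (b := a.rev)
      (Fin.rev_lt_rev.2 hbz) (Fin.rev_lt_rev.2 hyb) (Fin.rev_lt_rev.2 hay)
      (by simpa [_root_.mirror] using hE) (by simpa [_root_.mirror] using hyb')
      (by simpa [_root_.mirror] using hay') hun.mirror
      (fun r h1 h2 h3 => hzmin r.rev (Fin.lt_rev_iff.2 h2) (Fin.rev_lt_iff.2 h1)
        (by simpa [_root_.mirror] using h3)) ?_
    · simpa [_root_.mirror] using this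
    · obtain ⟨s, h1, h2, h3, h4, h5⟩ := hr z hbz haz'
      exact ⟨s.rev, Fin.rev_lt_rev.2 h2, Fin.rev_lt_rev.2 h1, by simpa using h3,
        by simpa [_root_.mirror] using h5, by simpa [_root_.mirror] using h4⟩
  have hxz' : E x z := h.trans_cross hxa hab hbz hxb' haz'
  have hside := @IsPersistent.not_adj_of_between _ _ h x a b z hab hE hxmax hzmin
  refine ⟨x, y, z, hxa, hay, hyb, hbz, ?_, ?_, ?_, ?_⟩
  · intro i hi j hj hij
    simp only [mem_insert, mem_singleton] at hi hj
    rcases hi with rfl | rfl | rfl | rfl | rfl <;> rcases hj with rfl | rfl | rfl | rfl | rfl <;>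
      first | assumption | omega
  · intro c d hxc hca had hdz hcd
    rcases lt_trichotomy d b with hdb | rfl | hbd
    · exact hxmax c hxc hca (h.trans_cross hca had hdb hcd hE)
    · exact hxmax c hxc hca hcd
    · exact hside hxc hca hbd hdz hcd
  · intro c d hxc hcb hbd hdz hcd
    rcases lt_trichotomy c a with hca | rfl | hac
    · exact hside hxc hca hbd hdz hcd
    · exact hzmin d hbd hdz hcd
    · exact hzmin d hbd hdz (h.trans_cross hac hcb hbd hE hcd)
  · intro c d hac hcy hyd hdb hcd
    have had' : E a d := by
      rcases hac.eq_or_lt with rfl | hac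
      · exact hcd
      · exact h.trans_cross hac hcy hyd hay' hcd
    obtain rfl : d = b := by
      rcases hdb.eq_or_lt with rfl | hdb
      · rfl
      · exact (hun y d hay hyd hdb had' hyb').elim
    rcases hac.eq_or_lt with rfl | hac
    · exact ⟨rfl, rfl⟩
    · exact (hun c y hac hcy hyb hay' hcd).elim

end Persistent

namespace CyclicTriangulation

variable {m : ℕ} {t : Fin m → ℝ}

/-- The edges of a triangulation. -/
def Edge (T : CyclicTriangulation t) (i j : Fin m) : Prop := ∃ S ∈ T.simplices, i ∈ S ∧ j ∈ S

theorem Edge.symm {T : CyclicTriangulation t} {i j : Fin m} (h : T.Edge i j) : T.Edge j i := by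
  obtain ⟨S, hS, hi, hj⟩ := h
  exact ⟨S, hS, hj, hi⟩

end CyclicTriangulation

/-! ### Radon points and the two triangulations of five vertices -/

section Radon

variable {m : ℕ} {t : Fin m → ℝ}

/-- The edge `v 1, v 3` and the triangle `v 0, v 2, v 4` meet in relatively interior points. -/
theorem exists_radon_point (ht : StrictMono t) {v : Fin 5 → Fin m} (hv : StrictMono v) :
    ∃ u w, IsConvexWeight {v 0, v 2, v 4} u ∧ IsConvexWeight {v 1, v 3} w ∧
      momentSum t u = momentSum t w ∧ 0 < u (v 0) ∧ 0 < u (v 2) ∧ 0 < u (v 4) ∧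
      0 < w (v 1) ∧ 0 < w (v 3) := by
  obtain ⟨g, hg, hsupp, h0, h1, h2, h3, h4⟩ := exists_radon ht hv
  set s := ∑ i, max (g i) 0 with hs
  obtain ⟨hg0, hgs⟩ := isMomentDependence_iff.1 hg
  have hmax : ∀ i, max (g i) 0 - max (-g i) 0 = g i := fun i => by
    rcases le_total (g i) 0 with h | h
    · rw [max_eq_right h, max_eq_left (by linarith)]; ring
    · rw [max_eq_left h, max_eq_right (by linarith)]; ring
  have hs' : s = ∑ i, max (-g i) 0 := by
    rw [← sub_eq_zero, hs, ← sum_sub_distrib, sum_congr rfl fun i _ => hmax i, hg0]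
  have hspos : 0 < s := sum_pos' (fun i _ => le_max_right _ _) ⟨v 0, mem_univ _, lt_max_of_lt_left h0⟩
  have hcase : ∀ i, g i ≠ 0 → ∃ j, v j = i := fun i hi => by
    by_contra! hno
    exact hi (hsupp i hno)
  refine ⟨fun i => s⁻¹ * max (g i) 0, fun i => s⁻¹ * max (-g i) 0,
    ⟨fun i => by positivity, fun i hi => ?_, ?_⟩, ⟨fun i => by positivity, fun i hi => ?_, ?_⟩,
    ?_, ?_, ?_, ?_, ?_, ?_⟩
  · suffices g i ≤ 0 by rw [max_eq_right this, mul_zero]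
    by_contra! hpos
    obtain ⟨j, rfl⟩ := hcase i hpos.ne'
    fin_cases j <;> simp at hi hpos <;> linarith
  · rw [← mul_sum, ← hs, inv_mul_cancel₀ hspos.ne']
  · suffices -g i ≤ 0 by rw [max_eq_right this, mul_zero]
    by_contra! hpos
    obtain ⟨j, rfl⟩ := hcase i (by intro h; rw [h] at hpos; simp at hpos)
    fin_cases j <;> simp at hi hpos <;> linarith
  · rw [← mul_sum, ← hs', inv_mul_cancel₀ hspos.ne']
  · rw [momentSum_smul, momentSum_smul]
    congr 1
    rw [← sub_eq_zero, ← hgs]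
    simp only [momentSum]
    rw [← sum_sub_distrib]
    exact sum_congr rfl fun i _ => by rw [← sub_smul, hmax]
  · exact mul_pos (inv_pos.2 hspos) (lt_max_of_lt_left h0)
  · exact mul_pos (inv_pos.2 hspos) (lt_max_of_lt_left h2)
  · exact mul_pos (inv_pos.2 hspos) (lt_max_of_lt_left h4)
  · exact mul_pos (inv_pos.2 hspos) (lt_max_of_lt_left (by linarith))
  · exact mul_pos (inv_pos.2 hspos) (lt_max_of_lt_left (by linarith))

/-- Subtracting multiples of `g` from `u` does not move the point. The minimal ratio `u i / g i`
over `P` is the moment when the first coordinate vanishes while all others are still nonnegative. -/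
theorem exists_move {S P : Finset (Fin m)} {u g : Fin m → ℝ} (hu : IsConvexWeight S u)
    (hg : IsMomentDependence t g) (hgS : ∀ i, i ∉ S → g i = 0) (hP : ∀ i, 0 < g i ↔ i ∈ P)
    (hne : P.Nonempty) : ∃ i ∈ P, momentSum t u ∈ momentHull t (S.erase i) := by
  obtain ⟨i, hi, hmin⟩ := exists_min_image P (fun i => u i / g i) hne
  have hgi := (hP i).2 hi
  obtain ⟨hg0, hgs⟩ := isMomentDependence_iff.1 hg
  refine ⟨i, hi, mem_momentHull.2 ⟨fun j => u j + -(u i / g i) * g j, ⟨fun j => ?_, fun j hj => ?_,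
    ?_⟩, ?_⟩⟩
  · by_cases hj : 0 < g j
    · have := hmin j ((hP j).1 hj)
      have : u i / g i * g j ≤ u j := by rwa [← le_div_iff₀ hj]
      linarith
    · have h1 := hu.nonneg j
      have h2 : 0 ≤ u i / g i := div_nonneg (hu.nonneg i) hgi.le
      nlinarith
  · by_cases hji : j = i
    · subst hji
      field_simp
      ring
    · have hjS : j ∉ S := fun h => hj (mem_erase.2 ⟨hji, h⟩)
      rw [hu.eq_zero j hjS, hgS j hjS]
      ring
  · rw [sum_add_distrib, ← mul_sum, hg0, hu.sum_eq]
    ring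
  · rw [momentSum_add, momentSum_smul, hgs, smul_zero, add_zero]

/-- The vertex set of the five points of a flip. -/
def flipSupport (v : Fin 5 → Fin m) : Finset (Fin m) := {v 0, v 1, v 2, v 3, v 4}

theorem subset_flipSupport_of_mem_lowerFlip {v : Fin 5 → Fin m} {S : Finset (Fin m)}
    (hS : S ∈ lowerFlip v) : S ⊆ flipSupport v := by
  simp only [lowerFlip, mem_insert, mem_singleton] at hS
  rcases hS with rfl | rfl | rfl <;> intro i hi <;>
    simp only [flipSupport, mem_insert, mem_singleton] at hi ⊢ <;> tauto

theorem subset_flipSupport_of_mem_upperFlip {v : Fin 5 → Fin m} {S : Finset (Fin m)}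
    (hS : S ∈ upperFlip v) : S ⊆ flipSupport v := by
  simp only [upperFlip, mem_insert, mem_singleton] at hS
  rcases hS with rfl | rfl <;> intro i hi <;>
    simp only [flipSupport, mem_insert, mem_singleton] at hi ⊢ <;> tauto

/-- The lower simplices omit one vertex of the positive part `v 0, v 2, v 4` of the Radon
dependence; the upper ones omit `v 1` or `v 3`, the negative part. -/
theorem iUnion_lowerFlip (ht : StrictMono t) {v : Fin 5 → Fin m} (hv : StrictMono v) :
    ⋃ S ∈ lowerFlip v, momentHull t S = momentHull t (flipSupport v) := by
  refine Set.Subset.antisymm (Set.iUnion₂_subset fun S hS =>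
    momentHull_mono t (subset_flipSupport_of_mem_lowerFlip hS)) ?_
  intro x hx
  obtain ⟨u, hu, rfl⟩ := mem_momentHull.1 hx
  obtain ⟨g, hg, hsupp, h0, h1, h2, h3, h4⟩ := exists_radon ht hv
  have hP : ∀ i, 0 < g i ↔ i ∈ ({v 0, v 2, v 4} : Finset (Fin m)) := by
    intro i
    constructor
    · intro hpos
      by_contra hi
      have : ∃ j, v j = i := by
        by_contra! hno
        exact hpos.ne' (hsupp i hno)
      obtain ⟨j, rfl⟩ := this
      fin_cases j <;> simp at hi hpos <;> linarith
    · simp only [mem_insert, mem_singleton]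
      rintro (rfl | rfl | rfl) <;> assumption
  obtain ⟨i, hi, hmem⟩ := exists_move (P := {v 0, v 2, v 4}) hu hg
    (fun i hi => hsupp i fun j => by
      rintro rfl
      fin_cases j <;> simp [flipSupport] at hi) hP ⟨v 0, by simp⟩
  refine Set.mem_iUnion₂.2 ⟨(flipSupport v).erase i, ?_, hmem⟩
  simp only [mem_insert, mem_singleton] at hi
  have h01 : v 0 < v 1 := hv (by decide)
  have h12 : v 1 < v 2 := hv (by decide)
  have h23 : v 2 < v 3 := hv (by decide)
  have h34 : v 3 < v 4 := hv (by decide)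
  simp only [lowerFlip, mem_insert, mem_singleton]
  rcases hi with rfl | rfl | rfl
  · right; right; ext j; simp only [flipSupport, mem_erase, mem_insert, mem_singleton]; omega
  · left; ext j; simp only [flipSupport, mem_erase, mem_insert, mem_singleton]; omega
  · right; left; ext j; simp only [flipSupport, mem_erase, mem_insert, mem_singleton]; omega

theorem iUnion_upperFlip (ht : StrictMono t) {v : Fin 5 → Fin m} (hv : StrictMono v) :
    ⋃ S ∈ upperFlip v, momentHull t S = momentHull t (flipSupport v) := by
  refine Set.Subset.antisymm (Set.iUnion₂_subset fun S hS =>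
    momentHull_mono t (subset_flipSupport_of_mem_upperFlip hS)) ?_
  intro x hx
  obtain ⟨u, hu, rfl⟩ := mem_momentHull.1 hx
  obtain ⟨g, hg, hsupp, h0, h1, h2, h3, h4⟩ := exists_radon ht hv
  have hP : ∀ i, 0 < -g i ↔ i ∈ ({v 1, v 3} : Finset (Fin m)) := by
    intro i
    constructor
    · intro hpos
      by_contra hi
      have : ∃ j, v j = i := by
        by_contra! hno
        exact hpos.ne' (by rw [hsupp i hno, neg_zero])
      obtain ⟨j, rfl⟩ := this
      fin_cases j <;> simp at hi hpos <;> linarith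
    · simp only [mem_insert, mem_singleton]
      rintro (rfl | rfl) <;> linarith
  obtain ⟨i, hi, hmem⟩ := exists_move (P := {v 1, v 3}) hu hg.neg
    (fun i hi => by
      rw [hsupp i fun j => by
        rintro rfl
        fin_cases j <;> simp [flipSupport] at hi, neg_zero]) hP ⟨v 1, by simp⟩
  refine Set.mem_iUnion₂.2 ⟨(flipSupport v).erase i, ?_, hmem⟩
  simp only [mem_insert, mem_singleton] at hi
  have h01 : v 0 < v 1 := hv (by decide)
  have h12 : v 1 < v 2 := hv (by decide)
  have h23 : v 2 < v 3 := hv (by decide)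
  have h34 : v 3 < v 4 := hv (by decide)
  simp only [upperFlip, mem_insert, mem_singleton]
  rcases hi with rfl | rfl
  · right; ext j; simp only [flipSupport, mem_erase, mem_insert, mem_singleton]; omega
  · left; ext j; simp only [flipSupport, mem_erase, mem_insert, mem_singleton]; omega

end Radon

/-! ### The edges of a triangulation form a persistent graph that determines it -/

namespace CyclicTriangulation

variable {m : ℕ} {t : Fin m → ℝ}

/-- The Radon point of the crossing lies in the common face `F`. By uniqueness of coordinates `F`
contains `p, q, r`, so `S` would have five vertices. -/
theorem not_crossing (T : CyclicTriangulation t) (ht : StrictMono t) {S S' : Finset (Fin m)}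
    (hS : S ∈ T.simplices) (hS' : S' ∈ T.simplices) : ¬ Crossing S S' := by
  rintro ⟨p, c, q, d, r, h1, h2, h3, h4, hc, hd, hp, hq, hr⟩
  have hv : StrictMono ![p, c, q, d, r] := by
    rw [Fin.strictMono_iff_lt_succ]
    intro i
    fin_cases i <;> assumption
  obtain ⟨u, w, hu, hw, huw, hup, huq, hur, hwc, hwd⟩ := exists_radon_point ht hv
  change IsConvexWeight {p, q, r} u at hu
  change IsConvexWeight {c, d} w at hw
  change 0 < u p at hup
  change 0 < u q at huq
  change 0 < u r at hur
  change 0 < w c at hwc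
  change 0 < w d at hwd
  have hu' : IsConvexWeight S' u := hu.mono (by intro i; simp; rintro (rfl | rfl | rfl) <;> assumption)
  have hw' : IsConvexWeight S w := hw.mono (by intro i; simp; rintro (rfl | rfl) <;> assumption)
  obtain ⟨F, hFS, hFS', hF⟩ := T.inter_face S hS S' hS'
  have hmem : momentSum t u ∈ momentHull t F := by
    rw [← hF]
    exact ⟨mem_momentHull.2 ⟨w, hw', huw.symm⟩, mem_momentHull.2 ⟨u, hu', rfl⟩⟩
  obtain ⟨g, hg, hgu⟩ := mem_momentHull.1 hmem
  have hself := not_crossing_self (T.card_eq S hS).le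
  have hself' := not_crossing_self (T.card_eq S' hS').le
  have hgw := (hg.mono hFS).eq_of_not_crossing ht hw' (hgu.trans huw) hself hself
  have hgu := (hg.mono hFS').eq_of_not_crossing ht hu' hgu hself' hself'
  have hF : ∀ {i}, 0 < g i → i ∈ S := fun {i} hi => by
    by_contra hiS
    exact hi.ne' (hg.eq_zero i fun h => hiS (hFS h))
  have hcard := five_le_card_of_lt h1 h2 h3 h4 (hF (hgu ▸ hup)) hc (hF (hgu ▸ huq)) hd
    (hF (hgu ▸ hur))
  rw [T.card_eq S hS] at hcard
  omega

theorem Edge.not_crossed {T : CyclicTriangulation t} (ht : StrictMono t) {S : Finset (Fin m)}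
    (hS : S ∈ T.simplices) {p c q d r : Fin m} (hcd : T.Edge c d) (hp : p ∈ S) (hq : q ∈ S)
    (hr : r ∈ S) (h1 : p < c) (h2 : c < q) (h3 : q < d) (h4 : d < r) : False := by
  obtain ⟨S', hS', hc, hd⟩ := hcd
  exact T.not_crossing ht hS' hS ⟨p, c, q, d, r, h1, h2, h3, h4, hc, hd, hp, hq, hr⟩

/-- The barycentre of `F` lies in some simplex `S`; its coordinates in `F` and `S` agree, and those
in `F` are positive on all of `F`. -/
theorem exists_superset (T : CyclicTriangulation t) (ht : StrictMono t) {F : Finset (Fin m)}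
    (hF : F.Nonempty) (h : ∀ S ∈ T.simplices, ¬ Crossing F S ∧ ¬ Crossing S F) :
    ∃ S ∈ T.simplices, F ⊆ S := by
  have hcard : (0 : ℝ) < F.card := by exact_mod_cast hF.card_pos
  have hu : IsConvexWeight F (fun i => if i ∈ F then (F.card : ℝ)⁻¹ else 0) := by
    refine ⟨fun i => ?_, fun i hi => by simp [hi], ?_⟩
    · split_ifs <;> positivity
    · simp [hcard.ne']
  have hmem := momentHull_mono t (subset_univ F) (mem_momentHull.2 ⟨_, hu, rfl⟩)
  rw [momentHull_univ, ← T.union_eq] at hmem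
  obtain ⟨S, hS, hxS⟩ := Set.mem_iUnion₂.1 hmem
  obtain ⟨w, hw, hwx⟩ := mem_momentHull.1 hxS
  have heq := hu.eq_of_not_crossing ht hw hwx.symm (h S hS).1 (h S hS).2
  refine ⟨S, hS, fun i hi => ?_⟩
  by_contra hiS
  have := congrFun heq i
  simp only [hi, if_true, hw.eq_zero i hiS] at this
  exact (inv_pos.2 hcard).ne' this

theorem edge_or_crossed (T : CyclicTriangulation t) (ht : StrictMono t) {a b : Fin m}
    (hab : a < b) : T.Edge a b ∨ ∃ S ∈ T.simplices, ∃ x ∈ S, ∃ y ∈ S, ∃ z ∈ S,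
      x < a ∧ a < y ∧ y < b ∧ b < z := by
  by_contra! hno
  obtain ⟨hE, hno⟩ := hno
  obtain ⟨S, hS, hsub⟩ := T.exists_superset ht (F := {a, b}) (by simp) fun S hS => by
    refine ⟨?_, ?_⟩
    · rintro ⟨p, c, q, d, r, h1, h2, h3, h4, hc, hd, hp, hq, hr⟩
      simp only [mem_insert, mem_singleton] at hc hd
      obtain rfl : c = a := by omega
      obtain rfl : d = b := by omega
      exact absurd h4 (not_lt.2 (hno S hS p hp q hq r hr h1 h2 h3))
    · rintro ⟨p, c, q, d, r, h1, h2, h3, h4, hc, hd, hp, hq, hr⟩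
      simp only [mem_insert, mem_singleton] at hp hq hr
      omega
  exact hE ⟨S, hS, hsub (by simp), hsub (by simp)⟩

theorem mem_simplices_of_not_crossed (T : CyclicTriangulation t) (ht : StrictMono t)
    {S : Finset (Fin m)} (hS : S.card = 4) (hE : ∀ i ∈ S, ∀ j ∈ S, i < j → T.Edge i j)
    (hno : ∀ p ∈ S, ∀ q ∈ S, ∀ r ∈ S, ∀ c d, p < c → c < q → q < d → d < r → ¬ T.Edge c d) :
    S ∈ T.simplices := by
  obtain ⟨S', hS', hsub⟩ := T.exists_superset ht (F := S) (card_pos.1 (by omega)) fun S' hS' => by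
    refine ⟨?_, ?_⟩
    · rintro ⟨p, c, q, d, r, h1, h2, h3, h4, hc, hd, hp, hq, hr⟩
      exact (hE c hc d hd (h2.trans h3)).not_crossed ht hS' hp hq hr h1 h2 h3 h4
    · rintro ⟨p, c, q, d, r, h1, h2, h3, h4, hc, hd, hp, hq, hr⟩
      exact hno p hp q hq r hr c d h1 h2 h3 h4 ⟨S', hS', hc, hd⟩
  rwa [eq_of_subset_of_card_le hsub (by rw [hS, T.card_eq S' hS'])]

theorem edge_trans_cross (T : CyclicTriangulation t) (ht : StrictMono t) {a b c d : Fin m}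
    (hab : a < b) (hbc : b < c) (hcd : c < d) (hac : T.Edge a c) (hbd : T.Edge b d) :
    T.Edge a d := by
  rcases T.edge_or_crossed ht (hab.trans (hbc.trans hcd)) with h |
    ⟨S, hS, x, hx, y, hy, z, hz, hxa, hay, hyd, hdz⟩
  · exact h
  · rcases lt_or_ge b y with hby | hyb
    · exact (hbd.not_crossed ht hS hx hy hz (hxa.trans hab) hby hyd hdz).elim
    · exact (hac.not_crossed ht hS hx hy hz hxa hay (hyb.trans_lt hbc) (hcd.trans hdz)).elim

theorem edge_of_consecutive (T : CyclicTriangulation t) (ht : StrictMono t) {a b : Fin m}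
    (hab : a < b) (h : ∀ s, a < s → b ≤ s) : T.Edge a b := by
  rcases T.edge_or_crossed ht hab with h' | ⟨S, hS, x, hx, y, hy, z, hz, hxa, hay, hyd, hdz⟩
  · exact h'
  · exact absurd (h y hay) (not_le.2 hyd)

theorem isPersistent_edge (T : CyclicTriangulation t) (ht : StrictMono t) :
    IsPersistent T.Edge where
  trans_cross := T.edge_trans_cross ht
  consecutive := T.edge_of_consecutive ht
  first {a b} ha hab := by
    rcases T.edge_or_crossed ht hab with h | ⟨S, hS, x, hx, y, hy, z, hz, hxa, hay, hyd, hdz⟩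
    · exact h
    · exact absurd (ha x) (not_le.2 hxa)
  last {a b} hb hab := by
    rcases T.edge_or_crossed ht hab with h | ⟨S, hS, x, hx, y, hy, z, hz, hxa, hay, hyd, hdz⟩
    · exact h
    · exact absurd (hb z) (not_le.2 hdz)
  bar {a s c} has hsc hac := by
    obtain ⟨b₀, hab₀, hb₀⟩ := exists_first ⟨s, has⟩
    have hb₀' : ∀ s, a < s → b₀ ≤ s := fun s hs => not_lt.1 fun hlt => hb₀ s hlt hs
    -- The support is the last neighbour `b` of `a` before `c`. A triangle `x y z` pierced by `b c`
    -- would be pierced by `a c` too, or else give the edge `a y` with `b < y < c`.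
    obtain ⟨b, ⟨hab, hbc, hE⟩, hmax⟩ := exists_last (P := fun b => a < b ∧ b < c ∧ T.Edge a b)
      ⟨b₀, hab₀, (hb₀' s has).trans_lt hsc, T.edge_of_consecutive ht hab₀ hb₀'⟩
    refine ⟨b, hab, hbc, hE, ?_⟩
    rcases T.edge_or_crossed ht hbc with h | ⟨S, hS, x, hx, y, hy, z, hz, hxb, hby, hyc, hcz⟩
    · exact h
    · rcases lt_trichotomy x a with hxa | rfl | hax
      · exact (hac.not_crossed ht hS hx hy hz hxa (hab.trans hby) hyc hcz).elim
      · exact (hmax y hby ⟨hab.trans hby, hyc, S, hS, hx, hy⟩).elim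
      · exact (hmax y hby ⟨hab.trans hby, hyc,
          T.edge_trans_cross ht hax hxb hby hE ⟨S, hS, hx, hy⟩⟩).elim

/-- A triangulation is determined by its edges. -/
theorem simplices_subset_of_edge_iff {T T' : CyclicTriangulation t} (ht : StrictMono t)
    (h : ∀ i j, i < j → (T.Edge i j ↔ T'.Edge i j)) : T.simplices ⊆ T'.simplices := by
  intro S hS
  refine T'.mem_simplices_of_not_crossed ht (T.card_eq S hS)
    (fun i hi j hj hij => (h i j hij).1 ⟨S, hS, hi, hj⟩) ?_
  intro p hp q hq r hr c d h1 h2 h3 h4 hcd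
  exact ((h c d (h2.trans h3)).2 hcd).not_crossed ht hS hp hq hr h1 h2 h3 h4

theorem eq_of_edge_iff {T T' : CyclicTriangulation t} (ht : StrictMono t)
    (h : ∀ i j, i < j → (T.Edge i j ↔ T'.Edge i j)) : T = T' := by
  have : T.simplices = T'.simplices := Subset.antisymm (simplices_subset_of_edge_iff ht h)
    (simplices_subset_of_edge_iff ht fun i j hij => (h i j hij).symm)
  cases T
  cases T'
  congr

end CyclicTriangulation

/-! ### Flips and their effect on edges -/

section Flip

variable {m : ℕ}

theorem card_flipSupport {v : Fin 5 → Fin m} (hv : StrictMono v) : (flipSupport v).card = 5 := by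
  have : flipSupport v = univ.image v := by
    ext i
    simp [flipSupport, Fin.exists_fin_succ, eq_comm]
  rw [this, card_image_of_injective _ hv.injective, card_univ, Fintype.card_fin]

theorem card_of_mem_lowerFlip {v : Fin 5 → Fin m} (hv : StrictMono v) {S : Finset (Fin m)}
    (hS : S ∈ lowerFlip v) : S.card = 4 := by
  have h01 : v 0 < v 1 := hv (by decide)
  have h12 : v 1 < v 2 := hv (by decide)
  have h23 : v 2 < v 3 := hv (by decide)
  have h34 : v 3 < v 4 := hv (by decide)
  simp only [lowerFlip, mem_insert, mem_singleton] at hS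
  rcases hS with rfl | rfl | rfl <;>
    (rw [card_insert_of_notMem, card_insert_of_notMem, card_insert_of_notMem, card_singleton] <;>
      simp only [mem_insert, mem_singleton] <;> omega)

theorem card_of_mem_upperFlip {v : Fin 5 → Fin m} (hv : StrictMono v) {S : Finset (Fin m)}
    (hS : S ∈ upperFlip v) : S.card = 4 := by
  have h01 : v 0 < v 1 := hv (by decide)
  have h12 : v 1 < v 2 := hv (by decide)
  have h23 : v 2 < v 3 := hv (by decide)
  have h34 : v 3 < v 4 := hv (by decide)
  simp only [upperFlip, mem_insert, mem_singleton] at hS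
  rcases hS with rfl | rfl <;>
    (rw [card_insert_of_notMem, card_insert_of_notMem, card_insert_of_notMem, card_singleton] <;>
      simp only [mem_insert, mem_singleton] <;> omega)

/-- The middle vertex `q` selects the condition to use: `left` for `a`, `right` for `b`, and all
three for `y`. -/
theorem IsFlippable.crossing {E : Fin m → Fin m → Prop} {x a y b z : Fin m}
    (h : IsFlippable E x a y b z) {p c q d r : Fin m}
    (hp : p ∈ ({x, a, y, b, z} : Finset (Fin m))) (hq : q ∈ ({x, a, y, b, z} : Finset (Fin m)))
    (hr : r ∈ ({x, a, y, b, z} : Finset (Fin m))) (h1 : p < c) (h2 : c < q) (h3 : q < d)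
    (h4 : d < r) (hE : E c d) : c = a ∧ d = b ∧ p = x ∧ q = y ∧ r = z := by
  obtain ⟨hxa, hay, hyb, hbz, -, hl, hr', hm⟩ := h
  simp only [mem_insert, mem_singleton] at hp hq hr
  have hxp : x ≤ p := by omega
  have hrz : r ≤ z := by omega
  rcases hq with rfl | rfl | rfl | rfl | rfl
  · omega
  · exact (hl c d (hxp.trans_lt h1) h2 h3 (h4.trans_le hrz) hE).elim
  · have hac : a ≤ c := not_lt.1 fun hca =>
      hl c d (hxp.trans_lt h1) hca (hay.trans h3) (h4.trans_le hrz) hE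
    have hdb : d ≤ b := not_lt.1 fun hbd =>
      hr' c d (hxp.trans_lt h1) (h2.trans hyb) hbd (h4.trans_le hrz) hE
    obtain ⟨rfl, rfl⟩ := hm c d hac h2 h3 hdb hE
    refine ⟨rfl, rfl, ?_, rfl, ?_⟩ <;> omega
  · exact (hr' c d (hxp.trans_lt h1) h2 h3 (h4.trans_le hrz) hE).elim
  · omega

theorem mem_lowerFlip_of_subset {v : Fin 5 → Fin m} (hv : StrictMono v) {S : Finset (Fin m)}
    (hS : S.card = 4) (hsub : S ⊆ flipSupport v) (h1 : v 1 ∈ S) (h3 : v 3 ∈ S) :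
    S ∈ lowerFlip v := by
  have h01 : v 0 < v 1 := hv (by decide)
  have h12 : v 1 < v 2 := hv (by decide)
  have h23 : v 2 < v 3 := hv (by decide)
  have h34 : v 3 < v 4 := hv (by decide)
  have hcard : (flipSupport v \ S).card = 1 := by
    rw [card_sdiff_of_subset hsub, card_flipSupport hv, hS]
  obtain ⟨w, hw⟩ := card_eq_one.1 hcard
  have hSw : S = flipSupport v \ {w} := by rw [← hw, Finset.sdiff_sdiff_eq_self hsub]
  have hw' : w ∈ flipSupport v \ S := by simp [hw]
  obtain ⟨hwv, hwS⟩ := mem_sdiff.1 hw'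
  rw [hSw]
  simp only [flipSupport, mem_insert, mem_singleton] at hwv
  simp only [lowerFlip, mem_insert, mem_singleton]
  rcases hwv with rfl | rfl | rfl | rfl | rfl
  · right; right; ext j; simp only [flipSupport, mem_sdiff, mem_insert, mem_singleton]; omega
  · exact absurd h1 hwS
  · left; ext j; simp only [flipSupport, mem_sdiff, mem_insert, mem_singleton]; omega
  · exact absurd h3 hwS
  · right; left; ext j; simp only [flipSupport, mem_sdiff, mem_insert, mem_singleton]; omega

end Flip

namespace CyclicTriangulation

variable {m : ℕ} {t : Fin m → ℝ}

theorem lowerFlip_subset_of_isFlippable (T : CyclicTriangulation t) (ht : StrictMono t)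
    {v : Fin 5 → Fin m} (hv : StrictMono v)
    (h : IsFlippable T.Edge (v 0) (v 1) (v 2) (v 3) (v 4)) : lowerFlip v ⊆ T.simplices := by
  intro S hS
  have hsub := subset_flipSupport_of_mem_lowerFlip hS
  refine T.mem_simplices_of_not_crossed ht (card_of_mem_lowerFlip hv hS)
    (fun i hi j hj hij => h.adj i (hsub hi) j (hsub hj) hij) ?_
  intro p hp q hq r hr c d h1 h2 h3 h4 hcd
  -- The only pierced triangle is `v 0, v 2, v 4`, and no lower simplex contains it.
  obtain ⟨-, -, rfl, rfl, rfl⟩ := h.crossing (hsub hp) (hsub hq) (hsub hr) h1 h2 h3 h4 hcd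
  have h01 : v 0 < v 1 := hv (by decide)
  have h12 : v 1 < v 2 := hv (by decide)
  have h23 : v 2 < v 3 := hv (by decide)
  have h34 : v 3 < v 4 := hv (by decide)
  simp only [lowerFlip, mem_insert, mem_singleton] at hS
  rcases hS with rfl | rfl | rfl <;> simp only [mem_insert, mem_singleton] at hp hq hr <;> omega

theorem isFlippable_of_lowerFlip_subset (T : CyclicTriangulation t) (ht : StrictMono t)
    {v : Fin 5 → Fin m} (hv : StrictMono v) (h : lowerFlip v ⊆ T.simplices) :
    IsFlippable T.Edge (v 0) (v 1) (v 2) (v 3) (v 4) := by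
  have h01 : v 0 < v 1 := hv (by decide)
  have h12 : v 1 < v 2 := hv (by decide)
  have h23 : v 2 < v 3 := hv (by decide)
  have h34 : v 3 < v 4 := hv (by decide)
  have hA : {v 0, v 1, v 3, v 4} ∈ T.simplices := h (by simp [lowerFlip])
  have hB : {v 0, v 1, v 2, v 3} ∈ T.simplices := h (by simp [lowerFlip])
  have hC : {v 1, v 2, v 3, v 4} ∈ T.simplices := h (by simp [lowerFlip])
  refine ⟨h01, h12, h23, h34, ?_, ?_, ?_, ?_⟩
  · intro i hi j hj hij
    simp only [mem_insert, mem_singleton] at hi hj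
    by_cases h2 : i = v 2 ∨ j = v 2
    · by_cases h0 : i = v 0
      · exact ⟨_, hB, by simp only [mem_insert, mem_singleton]; omega,
          by simp only [mem_insert, mem_singleton]; omega⟩
      · exact ⟨_, hC, by simp only [mem_insert, mem_singleton]; omega,
          by simp only [mem_insert, mem_singleton]; omega⟩
    · exact ⟨_, hA, by simp only [mem_insert, mem_singleton]; omega,
        by simp only [mem_insert, mem_singleton]; omega⟩
  · intro c d h1 h2 h3 h4 hcd
    exact hcd.not_crossed ht hA (p := v 0) (q := v 1) (r := v 4) (by simp) (by simp) (by simp)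
      h1 h2 h3 h4
  · intro c d h1 h2 h3 h4 hcd
    exact hcd.not_crossed ht hA (p := v 0) (q := v 3) (r := v 4) (by simp) (by simp) (by simp)
      h1 h2 h3 h4
  · intro c d h1 h2 h3 h4 hcd
    rcases h1.eq_or_lt with rfl | h1
    · rcases h4.eq_or_lt with rfl | h4
      · exact ⟨rfl, rfl⟩
      · exact (hcd.not_crossed ht hB (p := v 0) (q := v 2) (r := v 3) (by simp) (by simp) (by simp)
          h01 h2 h3 h4).elim
    · exact (hcd.not_crossed ht hC (p := v 1) (q := v 2) (r := v 4) (by simp) (by simp) (by simp)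
        h1 h2 h3 (h4.trans_lt h34)).elim

/-- All tetrahedra around a flippable edge take part in the flip. -/
theorem mem_lowerFlip_of_mem (T : CyclicTriangulation t) (ht : StrictMono t)
    {v : Fin 5 → Fin m} (hv : StrictMono v)
    (h : IsFlippable T.Edge (v 0) (v 1) (v 2) (v 3) (v 4)) {S : Finset (Fin m)}
    (hS : S ∈ T.simplices) (h1 : v 1 ∈ S) (h3 : v 3 ∈ S) : S ∈ lowerFlip v := by
  refine mem_lowerFlip_of_subset hv (T.card_eq S hS) (fun c hc => ?_) h1 h3
  obtain ⟨hxa, hay, hyb, hbz, hadj, hl, hr, hm⟩ := h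
  have hc1 : T.Edge (v 1) c := ⟨S, hS, h1, hc⟩
  have hc3 : T.Edge c (v 3) := ⟨S, hS, hc, h3⟩
  simp only [flipSupport, mem_insert, mem_singleton]
  -- A sixth vertex `c` beyond the outer ones gives a triangle with `v 1, v 3` pierced by `v 0, v 2`
  -- or `v 2, v 4`; in any gap it gives an edge excluded by `IsFlippable`.
  rcases lt_trichotomy c (v 0) with hcx | rfl | hxc
  · exact ((hadj (v 0) (by simp) (v 2) (by simp) (hxa.trans hay)).not_crossed ht hS hc h1 h3
      hcx hxa hay hyb).elim
  · simp
  rcases lt_trichotomy c (v 1) with hca | rfl | hac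
  · exact (hl c (v 3) hxc hca (hay.trans hyb) hbz hc3).elim
  · simp
  rcases lt_trichotomy c (v 2) with hcy | rfl | hyc
  · exact (hac.ne' (hm c (v 3) hac.le hcy hyb le_rfl hc3).1).elim
  · simp
  rcases lt_trichotomy c (v 3) with hcb | rfl | hbc
  · exact (hcb.ne (hm (v 1) c le_rfl hay hyc hcb.le hc1).2).elim
  · simp
  rcases lt_trichotomy c (v 4) with hcz | rfl | hzc
  · exact (hr (v 1) c hxa (hay.trans hyb) hbc hcz hc1).elim
  · simp
  · exact ((hadj (v 2) (by simp) (v 4) (by simp) (hyb.trans hbz)).not_crossed ht hS h1 h3 hc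
      hay hyb hbz hzc).elim

theorem edge_of_mem_flip (T : CyclicTriangulation t) (ht : StrictMono t)
    {v : Fin 5 → Fin m} (hv : StrictMono v) (h : lowerFlip v ⊆ T.simplices) {S : Finset (Fin m)}
    (hS : S ∈ T.simplices \ lowerFlip v ∪ upperFlip v) {i j : Fin m} (hi : i ∈ S) (hj : j ∈ S)
    (hij : i < j) : T.Edge i j ∧ ¬ (i = v 1 ∧ j = v 3) := by
  have hflip := T.isFlippable_of_lowerFlip_subset ht hv h
  rcases mem_union.1 hS with hS | hS
  · obtain ⟨hST, hSl⟩ := mem_sdiff.1 hS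
    refine ⟨⟨S, hST, hi, hj⟩, ?_⟩
    rintro ⟨rfl, rfl⟩
    exact hSl (T.mem_lowerFlip_of_mem ht hv hflip hST hi hj)
  · have hsub := subset_flipSupport_of_mem_upperFlip hS
    refine ⟨hflip.adj i (hsub hi) j (hsub hj) hij, ?_⟩
    rintro ⟨rfl, rfl⟩
    have h01 := hflip.xa
    have h12 := hflip.ay
    have h23 := hflip.yb
    have h34 := hflip.bz
    simp only [upperFlip, mem_insert, mem_singleton] at hS
    rcases hS with rfl | rfl <;> simp only [mem_insert, mem_singleton] at hi hj <;> omega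

/-- The new collection uses only old edges other than `v 1, v 3`, the one edge piercing the new
triangle, so nothing crosses. The union is unchanged because both halves of the flip fill the hull
of the five vertices. -/
theorem exists_flip (T : CyclicTriangulation t) (ht : StrictMono t)
    {v : Fin 5 → Fin m} (hv : StrictMono v) (h : lowerFlip v ⊆ T.simplices) :
    ∃ T' : CyclicTriangulation t, T'.simplices = T.simplices \ lowerFlip v ∪ upperFlip v := by
  have hcross : ∀ A ∈ T.simplices \ lowerFlip v ∪ upperFlip v,
      ∀ B ∈ T.simplices \ lowerFlip v ∪ upperFlip v, ¬ Crossing A B := by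
    rintro A hA B hB ⟨p, c, q, d, r, h1, h2, h3, h4, hc, hd, hp, hq, hr⟩
    obtain ⟨hcd, hne⟩ := T.edge_of_mem_flip ht hv h hA hc hd (h2.trans h3)
    rcases mem_union.1 hB with hB | hB
    · exact hcd.not_crossed ht (mem_sdiff.1 hB).1 hp hq hr h1 h2 h3 h4
    · have hsub := subset_flipSupport_of_mem_upperFlip hB
      obtain ⟨rfl, rfl, -⟩ := (T.isFlippable_of_lowerFlip_subset ht hv h).crossing
        (hsub hp) (hsub hq) (hsub hr) h1 h2 h3 h4 hcd
      exact hne ⟨rfl, rfl⟩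
  refine ⟨⟨T.simplices \ lowerFlip v ∪ upperFlip v, fun S hS => ?_, ?_, fun A hA B hB =>
    ⟨A ∩ B, inter_subset_left, inter_subset_right,
      momentHull_inter_of_not_crossing ht (hcross A hA B hB) (hcross B hB A hA)⟩⟩, rfl⟩
  · rcases mem_union.1 hS with hS | hS
    · exact T.card_eq S (mem_sdiff.1 hS).1
    · exact card_of_mem_upperFlip hv hS
  · rw [set_biUnion_union, iUnion_upperFlip ht hv, ← iUnion_lowerFlip ht hv, ← set_biUnion_union,
      sdiff_union_of_subset h, T.union_eq]

theorem edge_flip_iff {T T' : CyclicTriangulation t} (ht : StrictMono t)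
    {v : Fin 5 → Fin m} (hv : StrictMono v) (h : lowerFlip v ⊆ T.simplices)
    (hT' : T'.simplices = T.simplices \ lowerFlip v ∪ upperFlip v) {i j : Fin m} (hij : i < j) :
    T'.Edge i j ↔ T.Edge i j ∧ ¬ (i = v 1 ∧ j = v 3) := by
  constructor
  · rintro ⟨S, hS, hi, hj⟩
    exact T.edge_of_mem_flip ht hv h (hT' ▸ hS) hi hj hij
  · rintro ⟨⟨S, hS, hi, hj⟩, hne⟩
    by_cases hSl : S ∈ lowerFlip v
    · have hsub := subset_flipSupport_of_mem_lowerFlip hSl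
      have hi := hsub hi
      have hj := hsub hj
      simp only [flipSupport, mem_insert, mem_singleton] at hi hj
      have h01 : v 0 < v 1 := hv (by decide)
      have h12 : v 1 < v 2 := hv (by decide)
      have h23 : v 2 < v 3 := hv (by decide)
      have h34 : v 3 < v 4 := hv (by decide)
      -- A pair other than `v 1, v 3` misses one of these two vertices, hence lies in the upper
      -- simplex omitting that vertex.
      by_cases h3 : j = v 3 ∨ i = v 3
      · refine ⟨{v 0, v 2, v 3, v 4}, hT' ▸ mem_union_right _ (by simp [upperFlip]), ?_, ?_⟩ <;>
          simp only [mem_insert, mem_singleton] <;> omega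
      · refine ⟨{v 0, v 1, v 2, v 4}, hT' ▸ mem_union_right _ (by simp [upperFlip]), ?_, ?_⟩ <;>
          simp only [mem_insert, mem_singleton] <;> omega
    · exact ⟨S, hT' ▸ mem_union_left _ (mem_sdiff.2 ⟨hS, hSl⟩), hi, hj⟩

theorem exists_isUpFlip {T T' : CyclicTriangulation t} (ht : StrictMono t)
    (hle : ∀ i j, i < j → T'.Edge i j → T.Edge i j)
    (hne : ∃ i j, i < j ∧ T.Edge i j ∧ ¬ T'.Edge i j) :
    ∃ T₁ : CyclicTriangulation t, IsUpFlip T T₁ ∧ ∃ a b, a < b ∧ T.Edge a b ∧ ¬ T'.Edge a b ∧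
      ∀ i j, i < j → (T₁.Edge i j ↔ T.Edge i j ∧ ¬ (i = a ∧ j = b)) := by
  have hT := T.isPersistent_edge ht
  have hT' := T'.isPersistent_edge ht
  obtain ⟨a, b, hab, hE, hE', hun, hl, hr⟩ := hT.exists_removable hT' hle hne
  -- Consecutive pairs and pairs with the first or last vertex are edges of `T'`, so `a b` is none
  -- of these.
  have hmid : ∃ s, a < s ∧ s < b := by
    by_contra! hno
    exact hE' (hT'.consecutive hab hno)
  have hlt : ∃ s, s < a := by
    by_contra! hno
    exact hE' (hT'.first hno hab)
  have hgt : ∃ s, b < s := by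
    by_contra! hno
    exact hE' (hT'.last hno hab)
  obtain ⟨x, y, z, hflip⟩ := hT.exists_isFlippable hab hE hun hmid hlt hgt hl hr
  have hv : StrictMono ![x, a, y, b, z] := by
    obtain ⟨h1, h2, h3, h4, -⟩ := hflip
    rw [Fin.strictMono_iff_lt_succ]
    intro i
    fin_cases i <;> assumption
  have hsub := T.lowerFlip_subset_of_isFlippable ht hv hflip
  obtain ⟨T₁, hT₁⟩ := T.exists_flip ht hv hsub
  exact ⟨T₁, ⟨_, hv, hsub, hT₁⟩, a, b, hab, hE, hE', fun i j hij =>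
    edge_flip_iff ht hv hsub hT₁ hij⟩

theorem stasheffTamariLE_of_edge_le {T T' : CyclicTriangulation t} (ht : StrictMono t)
    (hle : ∀ i j, i < j → T'.Edge i j → T.Edge i j) : StasheffTamariLE T T' := by
  -- Each flip towards `T'` removes exactly one edge, so the number of edges decreases.
  induction hk : {e : Fin m × Fin m | e.1 < e.2 ∧ T.Edge e.1 e.2}.ncard
    using Nat.strong_induction_on generalizing T with
  | _ k ih =>
    by_cases hne : ∃ i j, i < j ∧ T.Edge i j ∧ ¬ T'.Edge i j
    · obtain ⟨T₁, hflip, a, b, hab, hE, hE', hiff⟩ := exists_isUpFlip ht hle hne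
      refine Relation.ReflTransGen.head hflip (ih _ ?_ (fun i j hij h => ?_) rfl)
      · rw [← hk]
        refine Set.ncard_lt_ncard ⟨fun e he => ⟨he.1, ((hiff _ _ he.1).1 he.2).1⟩, fun hsub => ?_⟩
        have hmem := hsub (show (a, b) ∈ _ from ⟨hab, hE⟩)
        exact ((hiff a b hab).1 hmem.2).2 ⟨rfl, rfl⟩
      · refine (hiff i j hij).2 ⟨hle i j hij h, ?_⟩
        rintro ⟨rfl, rfl⟩
        exact hE' h
    · push Not at hne
      rw [eq_of_edge_iff ht fun i j hij => ⟨hne i j hij, hle i j hij⟩]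
      exact Relation.ReflTransGen.refl

end CyclicTriangulation

/-! ### From the full edge relation to the graph on the inner vertices -/

section SkeletonGraph

variable {n : ℕ} {t : Fin (n + 2) → ℝ}

theorem innerVertex_lt_innerVertex {i j : Fin n} : innerVertex i < innerVertex j ↔ i < j := by
  simp [innerVertex]

theorem innerVertex_inj {i j : Fin n} : innerVertex i = innerVertex j ↔ i = j := by
  simp [innerVertex]

theorem exists_innerVertex {i a b : Fin (n + 2)} (ha : a < i) (hb : i < b) :
    ∃ i', innerVertex i' = i := by
  -- `innerVertex` shifts by one; `a < i` makes `i` positive, so the subtraction does not truncate.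
  refine ⟨⟨i - 1, by omega⟩, ?_⟩
  ext
  simp [innerVertex]
  omega

theorem skeletonGraph_adj {T : CyclicTriangulation t} {i j : Fin n} :
    (skeletonGraph T).Adj i j ↔ i ≠ j ∧ T.Edge (innerVertex i) (innerVertex j) := Iff.rfl

/-- Two triangulations can differ only in edges between inner vertices; this is why `Γ` suffices. -/
theorem CyclicTriangulation.exists_innerVertex_of_not_edge {T' : CyclicTriangulation t}
    (ht : StrictMono t) {i j : Fin (n + 2)} (hij : i < j) (h' : ¬ T'.Edge i j) :
    ∃ i' j', i' < j' ∧ innerVertex i' = i ∧ innerVertex j' = j := by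
  have hT' := T'.isPersistent_edge ht
  have hlt : ∃ s, s < i := by
    by_contra! hno
    exact h' (hT'.first hno hij)
  have hgt : ∃ s, j < s := by
    by_contra! hno
    exact h' (hT'.last hno hij)
  obtain ⟨a, ha⟩ := hlt
  obtain ⟨b, hb⟩ := hgt
  obtain ⟨i', rfl⟩ := exists_innerVertex ha hij
  obtain ⟨j', rfl⟩ := exists_innerVertex hij hb
  exact ⟨i', j', innerVertex_lt_innerVertex.1 hij, rfl, rfl⟩

theorem skeletonGraph_le_iff {T T' : CyclicTriangulation t} (ht : StrictMono t) :
    skeletonGraph T' ≤ skeletonGraph T ↔ ∀ i j, i < j → T'.Edge i j → T.Edge i j := by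
  constructor
  · intro h i j hij hE
    by_contra hE'
    obtain ⟨i', j', hij', rfl, rfl⟩ :=
      CyclicTriangulation.exists_innerVertex_of_not_edge ht hij hE'
    exact hE' (h (skeletonGraph_adj.2 ⟨hij'.ne, hE⟩)).2
  · intro h i j hadj
    refine ⟨hadj.1, ?_⟩
    rcases lt_or_gt_of_ne hadj.1 with hij | hij
    · exact h _ _ (innerVertex_lt_innerVertex.2 hij) hadj.2
    · exact (h _ _ (innerVertex_lt_innerVertex.2 hij) hadj.symm.2).symm

theorem IsUpFlip.edge_iff {m : ℕ} {t : Fin m → ℝ} {T T' : CyclicTriangulation t}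
    (ht : StrictMono t) (h : IsUpFlip T T') : ∃ x a b z, x < a ∧ a < b ∧ b < z ∧ T.Edge a b ∧
      ∀ i j, i < j → (T'.Edge i j ↔ T.Edge i j ∧ ¬ (i = a ∧ j = b)) := by
  obtain ⟨v, hv, hsub, hT'⟩ := h
  obtain ⟨h1, h2, h3, h4, hadj, -⟩ := T.isFlippable_of_lowerFlip_subset ht hv hsub
  exact ⟨v 0, v 1, v 3, v 4, h1, h2.trans h3, h4, hadj _ (by simp) _ (by simp) (h2.trans h3),
    fun i j hij => CyclicTriangulation.edge_flip_iff ht hv hsub hT' hij⟩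

theorem IsUpFlip.skeletonGraph_edgeSet {T T' : CyclicTriangulation t} (ht : StrictMono t)
    (h : IsUpFlip T T') : ∃ e ∈ (skeletonGraph T).edgeSet, e ∉ (skeletonGraph T').edgeSet ∧
      (skeletonGraph T).edgeSet = (skeletonGraph T').edgeSet ∪ {e} := by
  obtain ⟨x, a, b, z, hxa, hab, hbz, hE, hiff⟩ := h.edge_iff ht
  obtain ⟨a, rfl⟩ := exists_innerVertex hxa hab
  obtain ⟨b, rfl⟩ := exists_innerVertex hab hbz
  have hne := innerVertex_lt_innerVertex.1 hab
  have key : ∀ i j : Fin n, i < j →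
      ((skeletonGraph T).Adj i j ↔ (skeletonGraph T').Adj i j ∨ i = a ∧ j = b) := by
    intro i j hij
    rw [skeletonGraph_adj, skeletonGraph_adj, hiff _ _ (innerVertex_lt_innerVertex.2 hij),
      innerVertex_inj, innerVertex_inj]
    constructor
    · rintro ⟨h1, h2⟩
      by_cases h3 : i = a ∧ j = b
      · exact Or.inr h3
      · exact Or.inl ⟨h1, h2, h3⟩
    · rintro (⟨h1, h2, -⟩ | ⟨rfl, rfl⟩)
      · exact ⟨h1, h2⟩
      · exact ⟨hne.ne, hE⟩
  refine ⟨s(a, b), ⟨hne.ne, hE⟩, fun hmem => ((hiff _ _ hab).1 hmem.2).2 ⟨rfl, rfl⟩, ?_⟩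
  ext e
  induction e using Sym2.ind with
  | _ i j =>
    simp only [Set.mem_union, SimpleGraph.mem_edgeSet, Set.mem_singleton_iff, Sym2.eq_iff]
    rcases lt_trichotomy i j with hij | rfl | hij
    · rw [key i j hij]
      refine or_congr_right ⟨Or.inl, ?_⟩
      rintro (h | ⟨rfl, rfl⟩)
      · exact h
      · exact absurd hij hne.asymm
    · simp only [SimpleGraph.irrefl, false_or, false_iff]
      rintro (⟨rfl, rfl⟩ | ⟨rfl, rfl⟩) <;> exact hne.ne rfl
    · rw [(skeletonGraph T).adj_comm, (skeletonGraph T').adj_comm, key j i hij]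
      refine or_congr_right ⟨fun h => Or.inr h.symm, ?_⟩
      rintro (⟨rfl, rfl⟩ | h)
      · exact absurd hij hne.asymm
      · exact h.symm

/-- The flip towards `T'` removes an edge that `T'` lacks. As `e` is the only one, the result has
the edges of `T'` and hence equals `T'`. -/
theorem isUpFlip_of_skeletonGraph_edgeSet {T T' : CyclicTriangulation t} (ht : StrictMono t)
    {e : Sym2 (Fin n)} (he : e ∈ (skeletonGraph T).edgeSet) (he' : e ∉ (skeletonGraph T').edgeSet)
    (h : (skeletonGraph T).edgeSet = (skeletonGraph T').edgeSet ∪ {e}) : IsUpFlip T T' := by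
  have hle := (skeletonGraph_le_iff ht).1
    (SimpleGraph.edgeSet_subset_edgeSet.1 (h ▸ Set.subset_union_left) :
      skeletonGraph T' ≤ skeletonGraph T)
  have hne : ∃ i j, i < j ∧ T.Edge i j ∧ ¬ T'.Edge i j := by
    by_contra! hno
    exact he' (SimpleGraph.edgeSet_subset_edgeSet.2 ((skeletonGraph_le_iff ht).2 hno) he)
  obtain ⟨T₁, hflip, a, b, hab, hE, hE', hiff⟩ := CyclicTriangulation.exists_isUpFlip ht hle hne
  suffices T₁ = T' by rwa [← this]
  have hunique : ∀ i j, i < j → T.Edge i j → ¬ T'.Edge i j →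
      ∃ i' j', i' < j' ∧ innerVertex i' = i ∧ innerVertex j' = j ∧ e = s(i', j') := by
    intro i j hij hE hE'
    obtain ⟨i', j', hij', rfl, rfl⟩ :=
      CyclicTriangulation.exists_innerVertex_of_not_edge ht hij hE'
    refine ⟨i', j', hij', rfl, rfl, ?_⟩
    have hmem : s(i', j') ∈ (skeletonGraph T').edgeSet ∪ {e} := h ▸ ⟨hij'.ne, hE⟩
    rcases hmem with hmem | hmem
    · exact absurd hmem.2 hE'
    · exact hmem.symm
  obtain ⟨a', b', hab', rfl, rfl, rfl⟩ := hunique a b hab hE hE'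
  refine CyclicTriangulation.eq_of_edge_iff ht fun i j hij => ?_
  rw [hiff i j hij]
  constructor
  · rintro ⟨hij', hne⟩
    by_contra hno
    obtain ⟨i', j', hlt, rfl, rfl, heq⟩ := hunique i j hij hij' hno
    rcases Sym2.eq_iff.1 heq with ⟨rfl, rfl⟩ | ⟨rfl, rfl⟩
    · exact hne ⟨rfl, rfl⟩
    · exact absurd hlt hab'.asymm
  · intro hij'
    refine ⟨hle i j hij hij', ?_⟩
    rintro ⟨rfl, rfl⟩
    exact hE' hij'

end SkeletonGraph

theorem theorem3p1 (n : ℕ) (hn : 2 ≤ n) (t : Fin (n + 2) → ℝ) (ht : StrictMono t)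
    (T T' : CyclicTriangulation t) :
    (IsUpFlip T T' ↔
      ∃ e ∈ (skeletonGraph T).edgeSet, e ∉ (skeletonGraph T').edgeSet ∧
        (skeletonGraph T).edgeSet = (skeletonGraph T').edgeSet ∪ {e}) ∧
    (StasheffTamariLE T T' ↔ skeletonGraph T' ≤ skeletonGraph T) := by
  refine ⟨⟨fun h => h.skeletonGraph_edgeSet ht, ?_⟩, ?_, fun h =>
    CyclicTriangulation.stasheffTamariLE_of_edge_le ht ((skeletonGraph_le_iff ht).1 h)⟩
  · rintro ⟨e, he, he', h⟩
    exact isUpFlip_of_skeletonGraph_edgeSet ht he he' h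
  · intro h
    induction h with
    | refl => exact le_rfl
    | tail _ hflip ih =>
      obtain ⟨x, a, b, z, -, -, -, -, hiff⟩ := hflip.edge_iff ht
      exact ((skeletonGraph_le_iff ht).2 fun i j hij h => ((hiff i j hij).1 h).1).trans ih
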